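/- Notation. Let $m\ge 1$, $n\ge 0$, and $1\le r\le\binom{n+m}{m}$ be integers. Let $\sigma_r\subseteq\mathbb{P}(S^m(\mathbb{C}^{n+1}))$ be the Zariski closure of the set of classes of the tensors $u_1^{\otimes m}+\cdots+u_r^{\otimes m}$, and let $d=r(n+1)-1-\dim\sigma_r\ge 0$. For a nonzero symmetric tensor $F$ let $\mathrm{fiber}_r(F)$ be the set of $(u_1,\dots,u_r)\in\mathbb{P}((\mathbb{C}^{n+1})^r)$ with $F=\sum_j u_j^{\otimes m}$ for a suitable representative. Two such tuples are equivalent if they differ by a permutation of the $u_j$ and multiplication of each $u_j$ by an $m$-th root of unity; the equivalence classes are the decomposing classes (length-$r$ decompositions) of $F$. Write $F_\alpha=F_{i_1\dots i_m}$ when $x_{i_1}\cdots x_{i_m}=x^\alpha$ with $x_0=1$, for $\alpha\in\mathbb{N}^n$, $|\alpha|\le m$, and $\langle p,F\rangle=\sum_\alpha p_\alpha F_\alpha$ for $p\in\mathbb{C}[x_1,\dots,x_n]$ of degree $\le m$. Let $\mathbb{B}_0$ be the set of the first $r$ monomials in the graded lexicographic order $1\prec x_1\prec\cdots\prec x_n\prec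 x_1^2\prec x_1x_2\prec\cdots$, and $\mathbb{B}_1=(\mathbb{B}_0\cup x_1\mathbb{B}_0\cup\cdots\cup x_n\mathbb{B}_0)\setminus\mathbb{B}_0$. For $G\in\mathbb{C}^{\mathbb{B}_0\times\mathbb{B}_1}$ put $\varphi[G,\alpha]=\sum_{\beta\in\mathbb{B}_0}G(\beta,\alpha)x^\beta-x^\alpha$ for $\alpha\in\mathbb{B}_1$, and let $M_{x_i}(G)\in\mathbb{C}^{\mathbb{B}_0\times\mathbb{B}_0}$ be the matrix whose column $\nu$ is the unit vector $e_{\nu+e_i}$ if $x_ix^\nu\in\mathbb{B}_0$ and $G(:,\nu+e_i)$ otherwise. Let $\mathscr{G}(F)$ be the affine space of all $G$ with $\langle x^\gamma\varphi[G,\alpha],F\rangle=0$ for all $\alpha\in\mathbb{B}_1$ and $\gamma\in\mathbb{N}^n$ with $|\alpha|+|\gamma|\le m$. The algebraic algorithm, for input $F$: (0) parametrize $\mathscr{G}(F)$ bijectively as $G(\omega)=C+N(\omega)$, $\omega\in\mathbb{C}^\ell$, with $N$ linear. (1) Solve the equations $M_{x_i}(G(\omega))M_{x_j}(G(\omega))=M_{x_j}(G(\omega))M_{x_i}(G(\omega))$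 for all $i,j$, together with, if $d>0$, $d$ linear equations $a_k^T\omega=b_k$ $(k=1,\dots,d)$ with chosen $a_k\in\mathbb{C}^\ell$, $b_k\in\mathbb{C}$. (2) For each solution $w$ for which $\varphi[G(w)]$ has $r$ distinct common zeros $v_1,\dots,v_r\in\mathbb{C}^n$, determine $\lambda_1,\dots,\lambda_r$ from $F=\sum_j\lambda_j(1,v_j)^{\otimes m}$, and (3) output $(u_1,\dots,u_r)$ with $u_j=\sqrt[m]{\lambda_j}\,(1,v_j)$. **Proposition.** For a general $F\in\sigma_r$ (i.e. for all $F$ in some nonempty Zariski open subset of $\sigma_r$), Step 0 can be carried out, and for every parametrization in Step 0 the following hold. (i) If $d=0$, the algorithm finds all the decomposing classes of $F$: only finitely many solutions $w$ of Step 1 are such that $\varphi[G(w)]$ has $r$ distinct zeros; for each of them Steps 2 and 3 can be carried out, and all outputs from $w$ (for all orders of the zeros and all choices of roots) are decomposing tuples of $F$ in one and the same class; and the set of the classes so obtained is the set of all decomposing classes of $F$. (ii) If $d>0$, then for general $a_1,\dots,a_d\in\mathbb{C}^\ell$ and $b_1,\dots,b_d\in\mathbb{C}$ the algorithm finds a finite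 slice of the set of decomposing classes, cut out by the linear equations: again, only finitely many solutions $w$ of Step 1 are such that $\varphi[G(w)]$ has $r$ distinct zeros, and from each of them Steps 2 and 3 yield exactly one decomposing class; and the set of the classes so obtained is finite and nonempty and consists exactly of the classes of those $(u_1,\dots,u_r)\in\mathrm{fiber}_r(F)$ such that all $(u_j)_0\neq0$, the vectors of values of the monomials of $\mathbb{B}_0$ at the points $v_j=((u_j)_1,\dots,(u_j)_n)/(u_j)_0$, $j=1,\dots,r$, are linearly independent, and the parameter $\omega$ of the unique $G(\omega)\in\mathscr{G}(F)$ for which $\varphi[G(\omega)]$ vanishes at $v_1,\dots,v_r$ satisfies $a_k^T\omega=b_k$ for $k=1,\dots,d$. -/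

import Mathlib

open MvPolynomial

noncomputable section

namespace STD

/-! ### Symmetric tensors and secant varieties -/

/-- Arrays of order `m` over `ℂ^{n+1}`, with coordinates indexed by `0, …, n`. The symmetric tensors
are the arrays invariant under permutations of the index tuple. -/
abbrev Tensor (n m : ℕ) : Type := (Fin m → Fin (n + 1)) → ℂ

/-- The symmetric tensor power `u^{⊗m}`. -/
def tensorPow {n : ℕ} (m : ℕ) (u : Fin (n + 1) → ℂ) : Tensor n m :=
  fun i => ∏ k, u (i k)

/-- The sum `u₁^{⊗m} + ⋯ + u_r^{⊗m}`. -/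
def powSum {n r : ℕ} (m : ℕ) (u : Fin r → Fin (n + 1) → ℂ) : Tensor n m :=
  ∑ j, tensorPow m (u j)

/-- The affine cone over `σ_r`: the Zariski closure of the set of all sums of `r` symmetric
`m`-th powers (all its members are symmetric). The nonzero elements of the cone are the
representatives of the points of `σ_r ⊆ ℙ(S^m(ℂ^{n+1}))`. -/
def secantCone (n m r : ℕ) : Set (Tensor n m) :=
  zeroLocus ℂ (vanishingIdeal ℂ (Set.range fun u : Fin r → Fin (n + 1) → ℂ => powSum m u))

/-- The dimension of the affine cone over `σ_r`, as the transcendence degree over `ℂ` of its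
coordinate ring (the cone is irreducible). It equals `dim σ_r + 1`. -/
def secantConeDim (n m r : ℕ) : Cardinal :=
  Algebra.trdeg ℂ (MvPolynomial (Fin m → Fin (n + 1)) ℂ ⧸ vanishingIdeal ℂ (secantCone n m r))

/-- `d = r(n+1) - 1 - dim σ_r`, written as `d + (dim σ_r + 1) = r(n+1)`. -/
def IsDimensionGap (n m r d : ℕ) : Prop :=
  (d : Cardinal) + secantConeDim n m r = ((r * (n + 1) : ℕ) : Cardinal)

/-- A property `P` holds for a general tensor in `σ_r`: it holds on (representatives of) the points
of a nonempty open set of the irreducible variety `σ_r`, which may be taken to be the locus where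
some form `p` that does not vanish identically on `σ_r` is nonzero. -/
def ForGeneralTensor (n m r : ℕ) (P : Tensor n m → Prop) : Prop :=
  ∃ p : MvPolynomial (Fin m → Fin (n + 1)) ℂ, (∃ k, p.IsHomogeneous k) ∧
    (∃ F ∈ secantCone n m r, F ≠ 0 ∧ eval F p ≠ 0) ∧
    ∀ F ∈ secantCone n m r, F ≠ 0 → eval F p ≠ 0 → P F

/-- A property holds for general `a₁, …, a_d ∈ ℂ^ℓ` and `b₁, …, b_d ∈ ℂ`: it holds on a nonempty
Zariski open set. -/
def ForGeneralEquations (d ℓ : ℕ) (P : (Fin d → Fin ℓ → ℂ) → (Fin d → ℂ) → Prop) : Prop :=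
  ∃ q : MvPolynomial ((Fin d × Fin ℓ) ⊕ Fin d) ℂ, q ≠ 0 ∧
    ∀ a b, eval (Sum.elim (fun s => a s.1 s.2) b) q ≠ 0 → P a b

/-! ### Fibers of decompositions -/

/-- The fiber of length-`r` decompositions of `F`: the points of `ℙ((ℂ^{n+1})^r)` that have a
representative `(u₁, …, u_r)` with `F = u₁^{⊗m} + ⋯ + u_r^{⊗m}`. -/
def fiber {n m : ℕ} (r : ℕ) (F : Tensor n m) :
    Set (Projectivization ℂ (Fin r → Fin (n + 1) → ℂ)) :=
  {U | ∃ (u : Fin r → Fin (n + 1) → ℂ) (hu : u ≠ 0),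
    Projectivization.mk ℂ u hu = U ∧ F = powSum m u}

/-- Equality in projective space up to a permutation of the `u_j` and multiplication of each `u_j`
with an `m`-th root of unity. -/
def Equivalent {n r : ℕ} (m : ℕ) (U U' : Projectivization ℂ (Fin r → Fin (n + 1) → ℂ)) : Prop :=
  ∃ (u u' : Fin r → Fin (n + 1) → ℂ) (hu : u ≠ 0) (hu' : u' ≠ 0),
    Projectivization.mk ℂ u hu = U ∧ Projectivization.mk ℂ u' hu' = U' ∧
    ∃ (ν : Equiv.Perm (Fin r)) (τ : Fin r → ℂˣ),
      (∀ j, τ j ^ m = 1) ∧ ∀ j, u' j = (τ j : ℂ) • u (ν j)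

/-- Equivalence of decomposing tuples of `F`. -/
def fiberSetoid {n m : ℕ} (r : ℕ) (F : Tensor n m) : Setoid (fiber r F) where
  r U U' := Equivalent m U.1 U'.1
  iseqv := by
    refine ⟨?_, ?_, ?_⟩
    · rintro ⟨U, u, hu, h, -⟩
      exact ⟨u, u, hu, hu, h, h, 1, 1, by simp, by simp⟩
    · rintro ⟨U, _⟩ ⟨U', _⟩ ⟨u, u', hu, hu', h1, h2, ν, τ, hτ, e⟩
      refine ⟨u', u, hu', hu, h2, h1, ν⁻¹, fun j => (τ (ν⁻¹ j))⁻¹, ?_, ?_⟩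
      · intro j
        rw [inv_pow, hτ, inv_one]
      · intro j
        rw [e, smul_smul, Units.inv_mul, one_smul]
        simp
    · rintro ⟨U, _⟩ ⟨U', _⟩ ⟨U'', _⟩ ⟨u, u', hu, hu', h1, h2, ν, τ, hτ, e⟩
        ⟨w, w', hw, hw', k1, k2, ν', τ', hτ', e'⟩
      obtain ⟨c, hc⟩ := (Projectivization.mk_eq_mk_iff ℂ w u' hw hu').1 (k1.trans h2.symm)
      have hcu : c • u ≠ 0 := by
        rw [Units.smul_def]
        exact smul_ne_zero c.ne_zero hu
      refine ⟨c • u, w', hcu, hw', ?_, k2, ν * ν', fun j => τ' j * τ (ν' j), ?_, ?_⟩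
      · rw [← h1, Projectivization.mk_eq_mk_iff]
        exact ⟨c, rfl⟩
      · intro j
        rw [mul_pow, hτ, hτ', one_mul]
      · intro j
        rw [e', ← hc]
        ext i
        simp only [Pi.smul_apply, e, Units.smul_def, smul_eq_mul, Units.val_mul,
          Equiv.Perm.coe_mul, Function.comp_apply]
        ring

/-- The set of decomposing classes of `F`. -/
abbrev DecomposingClass {n m : ℕ} (r : ℕ) (F : Tensor n m) : Type := Quotient (fiberSetoid r F)

/-- The tuple `(u₁, …, u_r)` of vectors is a representative of the decomposing class `c`. -/
def Represents {n m r : ℕ} {F : Tensor n m} (u : Fin r → Fin (n + 1) → ℂ)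
    (c : DecomposingClass r F) : Prop :=
  F = powSum m u ∧
    ∃ (U : fiber r F) (hu : u ≠ 0), Projectivization.mk ℂ u hu = U.1 ∧ Quotient.mk _ U = c

/-! ### Monomial indexing and generating polynomials -/

/-- The graded lexicographic order `1 ≺ x₁ ≺ ⋯ ≺ x_n ≺ x₁² ≺ x₁x₂ ≺ ⋯` on exponents. -/
def GrlexLT {n : ℕ} (α β : Fin n →₀ ℕ) : Prop :=
  α.degree < β.degree ∨
    (α.degree = β.degree ∧ ∃ i, (∀ j < i, α j = β j) ∧ β i < α i)

/-- `𝔹₀`: (the exponents of) the first `r` monomials in the graded lexicographic order. -/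
def B0 (n r : ℕ) : Set (Fin n →₀ ℕ) :=
  {α | {β | GrlexLT β α}.ncard < r}

/-- `𝔹₁ = (𝔹₀ ∪ x₁𝔹₀ ∪ ⋯ ∪ x_n𝔹₀) \ 𝔹₀`. -/
def B1 (n r : ℕ) : Set (Fin n →₀ ℕ) :=
  {α | α ∉ B0 n r ∧ ∃ β ∈ B0 n r, ∃ i, α = β + Finsupp.single i 1}

theorem finite_degree_le (n k : ℕ) : {α : Fin n →₀ ℕ | α.degree ≤ k}.Finite := by
  refine Set.Finite.subset (Set.finite_Iic (Finsupp.equivFunOnFinite.symm fun _ => k)) ?_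
  intro α hα i
  exact (Finsupp.le_degree i α).trans hα

theorem finite_B0 (n r : ℕ) : (B0 n r).Finite := by
  refine (finite_degree_le n r).subset ?_
  intro α hα
  by_contra hcon
  have hlt : r < α.degree := not_le.1 hcon
  have hne : α ≠ 0 := by
    rintro rfl
    simp at hlt
  obtain ⟨i, -⟩ := Finsupp.ne_iff.1 hne
  have hfin : {β | GrlexLT β α}.Finite := by
    refine (finite_degree_le n α.degree).subset ?_
    rintro β (h | ⟨h, -⟩)
    · exact h.le
    · exact h.le
  have hsub : ((Finset.range r).image fun k => (Finsupp.single i k : Fin n →₀ ℕ) : Set _) ⊆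
      {β | GrlexLT β α} := by
    intro β hβ
    simp only [Finset.coe_image, Set.mem_image, Finset.coe_range, Set.mem_Iio] at hβ
    obtain ⟨k, hk, rfl⟩ := hβ
    left
    rw [Finsupp.degree_single]
    omega
  have hcard := Set.ncard_le_ncard hsub hfin
  rw [Set.ncard_coe_finset, Finset.card_image_of_injective _ (Finsupp.single_injective i),
    Finset.card_range] at hcard
  exact absurd hα (not_lt.2 hcard)

instance (n r : ℕ) : Fintype (B0 n r) := (finite_B0 n r).fintype

/-- The space `ℂ^{𝔹₀ × 𝔹₁}`. -/
abbrev GMatrix (n r : ℕ) : Type := Matrix (B0 n r) (B1 n r) ℂ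

open Classical in
/-- The entry `F_α = F_{i₁…i_m}` where `x_{i₁}⋯x_{i_m} = x^α` with `x₀ = 1`, for `|α| ≤ m`.
(For symmetric `F` the choice of `(i₁, …, i_m)` does not matter.) -/
def entry {n m : ℕ} (F : Tensor n m) (α : Fin n →₀ ℕ) : ℂ :=
  if h : ∃ i : Fin m → Fin (n + 1), ∀ j : Fin n, Nat.card {k // i k = j.succ} = α j then
    F h.choose
  else 0

/-- The pairing `⟨p, F⟩ = ∑ p_α F_α`, for polynomials `p` of degree at most `m`. -/
def pairing {n m : ℕ} (p : MvPolynomial (Fin n) ℂ) (F : Tensor n m) : ℂ :=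
  ∑ α ∈ p.support, p.coeff α * entry F α

/-- `φ[G, α] = ∑_{β ∈ 𝔹₀} G(β, α) x^β - x^α`. -/
def phi {n r : ℕ} (G : GMatrix n r) (α : B1 n r) : MvPolynomial (Fin n) ℂ :=
  ∑ β : B0 n r, monomial β.1 (G β α) - monomial α.1 1

/-- The set of common complex zeros of the polynomials `φ[G, α]`, `α ∈ 𝔹₁`. -/
def zeros {n r : ℕ} (G : GMatrix n r) : Set (Fin n → ℂ) :=
  {v | ∀ α, eval v (phi G α) = 0}

/-- The set `𝒢(F)` of generating matrices of `F`: all `φ[G, α]` are generating polynomials. -/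
def generatingMatrices {n m : ℕ} (r : ℕ) (F : Tensor n m) : Set (GMatrix n r) :=
  {G | ∀ (α : B1 n r) (γ : Fin n →₀ ℕ), α.1.degree + γ.degree ≤ m →
    pairing (phi G α * monomial γ 1) F = 0}

open Classical in
/-- The matrix `M_{x_i}(G)`. -/
def companion {n r : ℕ} (G : GMatrix n r) (i : Fin n) : Matrix (B0 n r) (B0 n r) ℂ :=
  fun μ ν =>
    if h : ν.1 + Finsupp.single i 1 ∈ B0 n r then
      if μ.1 = ν.1 + Finsupp.single i 1 then 1 else 0
    else G μ ⟨ν.1 + Finsupp.single i 1, h, ν.1, ν.2, i, rfl⟩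

/-- `φ[G]` has `r` distinct zeros. -/
def Nondefective {n r : ℕ} (G : GMatrix n r) : Prop := (zeros G).encard = r

/-! ### The algebraic algorithm -/

/-- The vector `(1, v)`. -/
def homog {n : ℕ} (v : Fin n → ℂ) : Fin (n + 1) → ℂ := Fin.cons 1 v

/-- The vector `(u₁, …, u_n) / u₀`. -/
def dehomog {n : ℕ} (u : Fin (n + 1) → ℂ) : Fin n → ℂ := fun i => u i.succ / u 0

/-- Step 0: an affine parametrization `ω ↦ G(ω) = C + N(ω)`, `ω ∈ ℂ^ℓ`, of `𝒢(F)`, without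
redundant parameters. -/
structure Parametrization {n m : ℕ} (r : ℕ) (F : Tensor n m) (ℓ : ℕ) where
  C : GMatrix n r
  N : (Fin ℓ → ℂ) →ₗ[ℂ] GMatrix n r
  injective : Function.Injective N
  range_eq : (Set.range fun ω => C + N ω) = generatingMatrices r F

/-- The generating matrix `G(ω)`. -/
def Parametrization.G {n m r ℓ : ℕ} {F : Tensor n m} (P : Parametrization r F ℓ)
    (ω : Fin ℓ → ℂ) : GMatrix n r := P.C + P.N ω

/-- Step 1: the solutions `ω` of `[M_{x_i}(G(ω)), M_{x_j}(G(ω))] = 0` for all `i, j`, together with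
the `d` linear equations `a_kᵀ ω = b_k` (there are none if `d = 0`). -/
def solutions {n m r ℓ d : ℕ} {F : Tensor n m} (P : Parametrization r F ℓ)
    (a : Fin d → Fin ℓ → ℂ) (b : Fin d → ℂ) : Set (Fin ℓ → ℂ) :=
  {ω | (∀ i j, companion (P.G ω) i * companion (P.G ω) j =
      companion (P.G ω) j * companion (P.G ω) i) ∧ ∀ k, a k ⬝ᵥ ω = b k}

/-- The solutions of Step 1 for which Step 2 finds `r` distinct zeros; the algorithm computes an
output from each of them. -/
def nondefectiveSolutions {n m r ℓ d : ℕ} {F : Tensor n m} (P : Parametrization r F ℓ)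
    (a : Fin d → Fin ℓ → ℂ) (b : Fin d → ℂ) : Set (Fin ℓ → ℂ) :=
  {ω ∈ solutions P a b | Nondefective (P.G ω)}

/-- Steps 2 and 3: the tuple `(u₁, …, u_r)` is a possible output computed from `G`. Here
`v₁, …, v_r` are the zeros of `φ[G]`, listed without repetition, the coefficients `λ_j` solve
`F = ∑ λ_j (1, v_j)^{⊗m}`, and `u_j` is `(1, v_j)` times some `m`-th root of `λ_j`. -/
def IsOutput {n m r : ℕ} (F : Tensor n m) (G : GMatrix n r) (u : Fin r → Fin (n + 1) → ℂ) : Prop :=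
  ∃ (v : Fin r → Fin n → ℂ) (lam ρ : Fin r → ℂ),
    Function.Injective v ∧ Set.range v = zeros G ∧
    F = ∑ j, lam j • tensorPow m (homog (v j)) ∧
    (∀ j, ρ j ^ m = lam j) ∧ ∀ j, u j = ρ j • homog (v j)

/-- The decomposing classes of the tuples that the algorithm outputs in a run with the
parametrization `P` and the linear equations given by `a` and `b`. -/
def classesFound {n m r ℓ d : ℕ} {F : Tensor n m} (P : Parametrization r F ℓ)
    (a : Fin d → Fin ℓ → ℂ) (b : Fin d → ℂ) : Set (DecomposingClass r F) :=
  {c | ∃ ω ∈ nondefectiveSolutions P a b, ∃ u, IsOutput F (P.G ω) u ∧ Represents u c}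

/-- The run is successful: only finitely many solutions of Step 1 lead to an output, each of them
does lead to an output, and all the outputs from the same solution (for any order of the zeros and
any choice of the `m`-th roots) are decomposing tuples in one and the same decomposing class. -/
def RunSucceeds {n m r ℓ d : ℕ} {F : Tensor n m} (P : Parametrization r F ℓ)
    (a : Fin d → Fin ℓ → ℂ) (b : Fin d → ℂ) : Prop :=
  (nondefectiveSolutions P a b).Finite ∧
    ∀ ω ∈ nondefectiveSolutions P a b,
      (∃ u, IsOutput F (P.G ω) u) ∧
      ∃ c : DecomposingClass r F, ∀ u, IsOutput F (P.G ω) u → Represents u c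

/-- The set `D`: the vectors `[v₁]_{𝔹₀}, …, [v_r]_{𝔹₀}` of values of the monomials in `𝔹₀` are
linearly independent. -/
def InD {n r : ℕ} (v : Fin r → Fin n → ℂ) : Prop :=
  LinearIndependent ℂ fun (j : Fin r) (β : B0 n r) => β.1.prod fun i e => v j i ^ e

/-- The slice of the set of decomposing classes cut out by the linear equations `a_kᵀ ω = b_k`: the
classes of those `(u₁, …, u_r)` with all `(u_j)₀ ≠ 0` and with dehomogenizations
`(v₁, …, v_r) ∈ D` for which the parameter `ω` of the (unique) generating matrix `G(ω)` such that
`φ[G(ω)]` vanishes at `v₁, …, v_r` satisfies the equations. -/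
def slice {n m r ℓ d : ℕ} {F : Tensor n m} (P : Parametrization r F ℓ)
    (a : Fin d → Fin ℓ → ℂ) (b : Fin d → ℂ) : Set (DecomposingClass r F) :=
  {c | ∃ u : Fin r → Fin (n + 1) → ℂ, Represents u c ∧ (∀ j, u j 0 ≠ 0) ∧
    InD (fun j => dehomog (u j)) ∧
    ∃ ω, (∀ j, dehomog (u j) ∈ zeros (P.G ω)) ∧ ∀ k, a k ⬝ᵥ ω = b k}

end STD

end

open STD

/-! Let `A` be the coordinate ring of the cone over `σ_r`, and `L` that of the set of points `(λ_j,
v_j)_j` with `(v_j)` in `D` (`CoordRing`, `LocRing`). The map `(λ, v) ↦ ∑ λ_j (1, v_j)^{⊗m}` is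
dominant onto the cone, since every `λ_j` has an `m`-th root. So `A` embeds in `L`, and `L` has
transcendence degree `d` over `A`. On `D` the matrix `V` of values of `𝔹₀` is invertible, and `φ[G]`
vanishes at all `v_j` exactly when `V G = W`, where `W` holds the values of `𝔹₁`; hence `G = V⁻¹ W`
has entries in `L`.

The crux is that `L` is algebraic over `A` with the entries of `G` adjoined
(`isAlgebraic_of_generatingMatrix`): the coordinates of the `v_j` are eigenvalues of the companion
matrices of `G`, and `λ` solves a linear system with matrix `V` whose right side consists of entries
of `F`. Therefore some `d` entries of `G` form a transcendence basis of `L` over `A`. Then `d`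
linear forms in the entries with indeterminate coefficients, together with these coefficients, are
again a transcendence basis (`isTranscendenceBasis_genericForms`). So the ring of the data `(F, a,
b)` has the ring of the data `(λ, v, a)` as an injective algebraic extension. Over a general point
such an extension has a finite nonempty fiber, on which a given nonzero element, here `∏ λ_j`,
vanishes nowhere (`exists_general_fiber`). This yields `exists_hasGeneralSlices`, for equations in
the entries of `G`; `Parametrization.forGeneralEquations` carries it over to equations in `ω`.

The rest is a dictionary between solutions and decompositions (`run_of_sliceSet`). Modulo `φ[G]`
every polynomial reduces to the span of `𝔹₀`, so `r` distinct zeros always lie in `D`; the same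
reduction within degree `m` shows that `F` is a combination of the powers given by the zeros of any
`G ∈ 𝒢(F)` with `r` distinct zeros. Conversely, a decomposition in `D` determines `G`, whose
companion matrices have a common eigenbasis and hence commute.

If `d = 0`, it remains to see that all decompositions lie in `D`. Then the polynomial ring in the
coordinates of the `u_j` is algebraic over `A`, so the polynomial whose nonvanishing puts a tuple in
`D` has no zero among the decompositions of a general `F` (`exists_general_inD`). Finally, all
conditions are invariant under scaling `F`, which allows the open set to be given by a form
(`forGeneralTensor_of_smul`). -/

namespace STD

/-! ### Extension of points along algebraic ring extensions -/

section Extension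

variable {R S : Type*} [CommRing R] [CommRing S] [Algebra ℂ R] [Algebra ℂ S] [Algebra R S]

/-- If `z` is algebraic over `R`, its value under homomorphisms to `ℂ` that extend a general
homomorphism `R → ℂ` lies in a finite set. -/
theorem exists_finite_values [IsDomain R] {z : S} (hz : IsAlgebraic R z) :
    ∃ f : R, f ≠ 0 ∧ ∀ φ : R →ₐ[ℂ] ℂ, φ f ≠ 0 →
      {y : ℂ | ∃ ψ : S →ₐ[ℂ] ℂ, (∀ x, ψ (algebraMap R S x) = φ x) ∧ ψ z = y}.Finite := by
  obtain ⟨p, hp0, hp⟩ := hz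
  -- Where the leading coefficient survives, the specialized `p` is a nonzero polynomial over `ℂ`,
  -- and every value of `z` is one of its roots.
  refine ⟨p.leadingCoeff, by simpa using hp0, fun φ hφ => ?_⟩
  have hq : p.map (φ : R →+* ℂ) ≠ 0 := by
    intro h
    apply hφ
    have := congrArg (fun q => Polynomial.coeff q p.natDegree) h
    simpa [Polynomial.coeff_map] using this
  refine (p.map (φ : R →+* ℂ)).roots.toFinset.finite_toSet.subset ?_
  rintro y ⟨ψ, hψ, rfl⟩
  simp only [Finset.mem_coe, Multiset.mem_toFinset, Polynomial.mem_roots hq, Polynomial.IsRoot,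
    Polynomial.eval_map]
  have h2 : (ψ : S →+* ℂ).comp (algebraMap R S) = (φ : R →+* ℂ) := RingHom.ext hψ
  have := congrArg (ψ : S →+* ℂ) hp
  rw [Polynomial.aeval_def, Polynomial.hom_eval₂, h2, map_zero] at this
  exact this

/-- A nonzero algebraic element does not vanish under homomorphisms to `ℂ` that extend a general
homomorphism `R → ℂ`. -/
theorem exists_value_ne_zero [IsDomain S] {z : S} (hz : IsAlgebraic R z) (hz0 : z ≠ 0) :
    ∃ f : R, f ≠ 0 ∧ ∀ φ : R →ₐ[ℂ] ℂ, φ f ≠ 0 →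
      ∀ ψ : S →ₐ[ℂ] ℂ, (∀ x, ψ (algebraMap R S x) = φ x) → ψ z ≠ 0 := by
  -- As `z` is not a zero divisor, its equation can be divided by a power of the variable until the
  -- constant term is nonzero. A zero value of `z` would make `φ` kill that term.
  obtain ⟨p, hp, hp0⟩ := hz.exists_nonzero_coeff_and_aeval_eq_zero
    (mem_nonZeroDivisors_of_ne_zero hz0)
  refine ⟨p.coeff 0, hp, fun φ hφ ψ hψ h0 => hφ ?_⟩
  have h2 : (ψ : S →+* ℂ).comp (algebraMap R S) = (φ : R →+* ℂ) := RingHom.ext hψ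
  have := congrArg (ψ : S →+* ℂ) hp0
  rw [Polynomial.aeval_def, Polynomial.hom_eval₂, h2, map_zero] at this
  have h3 : (ψ : S →+* ℂ) z = 0 := h0
  rw [h3, Polynomial.eval₂_at_zero] at this
  exact this

/-- A maximal ideal of a finitely generated `ℂ`-algebra is the kernel of a `ℂ`-valued point. -/
theorem exists_algHom_of_ne_top {S : Type*} [CommRing S] [Algebra ℂ S] [Algebra.FiniteType ℂ S]
    {J : Ideal S} (hJ : J ≠ ⊤) : ∃ ψ : S →ₐ[ℂ] ℂ, ∀ x ∈ J, ψ x = 0 := by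
  obtain ⟨M, hM, hJM⟩ := Ideal.exists_le_maximal J hJ
  let _ := Ideal.Quotient.field M
  have : Module.Finite ℂ (S ⧸ M) := finite_of_finite_type_of_isJacobsonRing ℂ (S ⧸ M)
  have hb := IsAlgClosed.algebraMap_bijective_of_isIntegral (k := ℂ) (K := S ⧸ M)
  let e : ℂ ≃ₐ[ℂ] (S ⧸ M) := AlgEquiv.ofBijective (Algebra.ofId ℂ (S ⧸ M)) hb
  refine ⟨(e.symm : (S ⧸ M) →ₐ[ℂ] ℂ).comp (Ideal.Quotient.mkₐ ℂ M), fun x hx => ?_⟩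
  have : Ideal.Quotient.mkₐ ℂ M x = 0 := Ideal.Quotient.eq_zero_iff_mem.2 (hJM hx)
  rw [AlgHom.comp_apply, this, map_zero]

/-- A general `ℂ`-valued point of `R` extends to `S`. -/
theorem exists_extension [IsDomain R] [IsScalarTower ℂ R S] [Algebra.FiniteType ℂ S]
    [Algebra.IsAlgebraic R S]
    (hinj : Function.Injective (algebraMap R S)) :
    ∃ f : R, f ≠ 0 ∧ ∀ φ : R →ₐ[ℂ] ℂ, φ f ≠ 0 →
      ∃ ψ : S →ₐ[ℂ] ℂ, ∀ x, ψ (algebraMap R S x) = φ x := by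
  obtain ⟨s, hs⟩ := Algebra.FiniteType.out (R := ℂ) (A := S)
  -- `f` clears the denominators of all generators at once, so each element of `S` becomes integral
  -- after multiplication by a power of `f`.
  obtain ⟨f, hf, hint⟩ := Algebra.IsAlgebraic.exists_integral_multiples R s
  refine ⟨f, hf, fun φ hφ => ?_⟩
  have key : ∀ x : S, ∃ k : ℕ, IsIntegral R (f ^ k • x) := by
    intro x
    have hx : x ∈ Algebra.adjoin ℂ (s : Set S) := by rw [hs]; trivial
    induction hx using Algebra.adjoin_induction with
    | mem x hx => exact ⟨1, by simpa using hint x hx⟩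
    | algebraMap c =>
      refine ⟨0, ?_⟩
      rw [pow_zero, one_smul, IsScalarTower.algebraMap_apply ℂ R S]
      exact isIntegral_algebraMap
    | add x y _ _ hx hy =>
      obtain ⟨k, hk⟩ := hx
      obtain ⟨l, hl⟩ := hy
      refine ⟨k + l, ?_⟩
      rw [smul_add]
      refine IsIntegral.add ?_ ?_
      · rw [pow_add, mul_comm, mul_smul]
        exact hk.smul _
      · rw [pow_add, mul_smul]
        exact hl.smul _
    | mul x y _ _ hx hy =>
      obtain ⟨k, hk⟩ := hx
      obtain ⟨l, hl⟩ := hy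
      refine ⟨k + l, ?_⟩
      have : f ^ (k + l) • (x * y) = (f ^ k • x) * (f ^ l • y) := by
        rw [smul_mul_smul_comm, pow_add]
      rw [this]
      exact hk.mul hl
  -- Lying over holds for `S'` and gives a prime `Q` above the kernel of `φ`. If `Q` generated the
  -- unit ideal of `S`, clearing denominators would put a power of `f` into `Q`, against `φ f ≠ 0`.
  let S' := integralClosure R S
  let P : Ideal R := RingHom.ker φ
  have : P.IsPrime := RingHom.ker_isPrime φ
  have hkerle : RingHom.ker (algebraMap R S') ≤ P := by
    intro x hx
    have h0 : algebraMap R S x = 0 := congrArg (algebraMap S' S) hx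
    rw [(injective_iff_map_eq_zero _).1 hinj x h0]
    exact P.zero_mem
  obtain ⟨Q, -, hQ, hQP⟩ := Ideal.exists_ideal_over_prime_of_isIntegral P (⊥ : Ideal S') hkerle
  have hfQ : algebraMap R S' f ∉ Q := by
    intro h
    have : f ∈ P := by rw [← hQP]; exact h
    exact hφ this
  have hJ : Ideal.map (algebraMap S' S) Q ≠ ⊤ := by
    intro htop
    have hclaim : ∀ x ∈ Ideal.map (algebraMap S' S) Q, ∃ k : ℕ, ∃ q ∈ Q, f ^ k • x = (q : S) := by
      intro x hx
      induction hx using Submodule.span_induction with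
      | mem x hx =>
        obtain ⟨q, hq, rfl⟩ := hx
        exact ⟨0, q, hq, by rw [pow_zero, one_smul]; rfl⟩
      | zero => exact ⟨0, 0, Q.zero_mem, by simp⟩
      | add x y _ _ hx hy =>
        obtain ⟨k, q, hq, e⟩ := hx
        obtain ⟨l, q', hq', e'⟩ := hy
        refine ⟨k + l, f ^ l • q + f ^ k • q', Q.add_mem ?_ ?_, ?_⟩
        · rw [Algebra.smul_def]; exact Q.mul_mem_left _ hq
        · rw [Algebra.smul_def]; exact Q.mul_mem_left _ hq'
        · simp only [smul_add, Subalgebra.coe_add, Subalgebra.coe_smul, ← e, ← e', smul_smul,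
            pow_add, mul_comm]
      | smul a x _ hx =>
        obtain ⟨k, q, hq, e⟩ := hx
        obtain ⟨l, hl⟩ := key a
        refine ⟨l + k, ⟨f ^ l • a, hl⟩ * q, Q.mul_mem_left _ hq, ?_⟩
        simp only [Subalgebra.coe_mul, ← e, smul_mul_smul_comm, pow_add, smul_eq_mul]
    obtain ⟨k, q, hq, e⟩ := hclaim 1 (by rw [htop]; trivial)
    apply hfQ
    apply hQ.mem_of_pow_mem k
    have : (algebraMap R S' f) ^ k = q := by
      apply Subtype.ext
      rw [← e, ← map_pow, Algebra.smul_def, mul_one]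
      rfl
    rwa [this]
  obtain ⟨ψ, hψ⟩ := exists_algHom_of_ne_top hJ
  refine ⟨ψ, fun x => ?_⟩
  have hx : x - algebraMap ℂ R (φ x) ∈ P := by
    change φ _ = 0
    simp
  rw [← hQP] at hx
  have h0 := hψ _ (Ideal.mem_map_of_mem (algebraMap S' S) hx)
  have h1 : algebraMap S' S (algebraMap R S' (x - algebraMap ℂ R (φ x))) =
      algebraMap R S x - algebraMap ℂ S (φ x) := by
    rw [← IsScalarTower.algebraMap_apply, map_sub, ← IsScalarTower.algebraMap_apply]
  rw [h1, map_sub, AlgHom.commutes, sub_eq_zero] at h0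
  simpa using h0

/-- Over a general `ℂ`-valued point of `R`, an algebraic extension `S` of finite type has at least
one and only finitely many points, and a given nonzero element vanishes at none of them. -/
theorem exists_general_fiber [IsDomain R] [IsDomain S] [IsScalarTower ℂ R S]
    [Algebra.FiniteType ℂ S] [Algebra.IsAlgebraic R S]
    (hinj : Function.Injective (algebraMap R S)) {z : S} (hz : z ≠ 0) :
    ∃ f : R, f ≠ 0 ∧ ∀ φ : R →ₐ[ℂ] ℂ, φ f ≠ 0 →
      (∃ ψ : S →ₐ[ℂ] ℂ, ∀ x, ψ (algebraMap R S x) = φ x) ∧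
      {ψ : S →ₐ[ℂ] ℂ | ∀ x, ψ (algebraMap R S x) = φ x}.Finite ∧
      ∀ ψ : S →ₐ[ℂ] ℂ, (∀ x, ψ (algebraMap R S x) = φ x) → ψ z ≠ 0 := by
  obtain ⟨f₁, hf₁, h₁⟩ := exists_extension (R := R) (S := S) hinj
  obtain ⟨f₂, hf₂, h₂⟩ := exists_value_ne_zero (R := R) (Algebra.IsAlgebraic.isAlgebraic z) hz
  choose g hg h₃ using fun y : S => exists_finite_values (R := R) (S := S)
    (Algebra.IsAlgebraic.isAlgebraic y)
  obtain ⟨s, hs⟩ := Algebra.FiniteType.out (R := ℂ) (A := S)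
  refine ⟨f₁ * f₂ * ∏ y ∈ s, g y,
    mul_ne_zero (mul_ne_zero hf₁ hf₂) (Finset.prod_ne_zero_iff.2 fun y _ => hg y), ?_⟩
  intro φ hφ
  rw [map_mul, map_mul, map_prod] at hφ
  have hφ₁ : φ f₁ ≠ 0 := left_ne_zero_of_mul (left_ne_zero_of_mul hφ)
  have hφ₂ : φ f₂ ≠ 0 := right_ne_zero_of_mul (left_ne_zero_of_mul hφ)
  have hφ₃ := Finset.prod_ne_zero_iff.1 (right_ne_zero_of_mul hφ)
  refine ⟨h₁ φ hφ₁, ?_, h₂ φ hφ₂⟩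
  -- A point of `S` is determined by its values on the finite generating set, and each of these
  -- values ranges over a finite set.
  let ev : (S →ₐ[ℂ] ℂ) → (s → ℂ) := fun ψ y => ψ y
  have hev : Function.Injective ev := by
    intro ψ ψ' h
    refine AlgHom.ext_of_adjoin_eq_top hs fun y hy => ?_
    exact congrFun h ⟨y, hy⟩
  refine Set.Finite.of_finite_image (f := ev) ?_ hev.injOn
  refine (Set.Finite.pi' fun y : s => h₃ y φ (hφ₃ y y.2)).subset ?_
  rintro _ ⟨ψ, hψ, rfl⟩ y
  exact ⟨ψ, hψ, rfl⟩

end Extension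

/-! ### The graded lexicographic order -/

theorem GrlexLT.degree_le {n : ℕ} {α β : Fin n →₀ ℕ} (h : GrlexLT α β) : α.degree ≤ β.degree :=
  h.elim le_of_lt fun h => h.1.le

theorem GrlexLT.irrefl {n : ℕ} (α : Fin n →₀ ℕ) : ¬ GrlexLT α α := by
  rintro (h | ⟨-, i, -, h⟩) <;> exact lt_irrefl _ h

theorem GrlexLT.trans {n : ℕ} {α β γ : Fin n →₀ ℕ} (h : GrlexLT α β) (h' : GrlexLT β γ) :
    GrlexLT α γ := by
  rcases h with h | ⟨h, i, hi, hi'⟩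
  · exact Or.inl (h.trans_le h'.degree_le)
  · rcases h' with h' | ⟨h', j, hj, hj'⟩
    · exact Or.inl (h.trans_lt h')
    · refine Or.inr ⟨h.trans h', ?_⟩
      rcases lt_trichotomy i j with hij | rfl | hij
      · exact ⟨i, fun k hk => (hi k hk).trans (hj k (hk.trans hij)), by rwa [← hj i hij]⟩
      · exact ⟨i, fun k hk => (hi k hk).trans (hj k hk), hj'.trans hi'⟩
      · exact ⟨j, fun k hk => (hi k (hk.trans hij)).trans (hj k hk), by rwa [hi j hij]⟩

theorem GrlexLT.trichotomy {n : ℕ} {α β : Fin n →₀ ℕ} (hne : α ≠ β) :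
    GrlexLT α β ∨ GrlexLT β α := by
  rcases lt_trichotomy α.degree β.degree with h | h | h
  · exact Or.inl (Or.inl h)
  · have hex : ∃ i, α i ≠ β i := Finsupp.ne_iff.1 hne
    obtain ⟨i, hi, hmin⟩ := (Finset.univ.filter fun i => α i ≠ β i).exists_minimal
      (hex.elim fun i hi => ⟨i, by simpa using hi⟩)
    have hlt : ∀ j < i, α j = β j := by
      intro j hj
      by_contra hcon
      exact absurd (hmin (by simpa using hcon) hj.le) (not_le.2 hj)
    simp only [Finset.mem_filter, Finset.mem_univ, true_and] at hi
    rcases lt_or_gt_of_ne hi with hi | hi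
    · exact Or.inr (Or.inr ⟨h.symm, i, fun j hj => (hlt j hj).symm, hi⟩)
    · exact Or.inl (Or.inr ⟨h, i, hlt, hi⟩)
  · exact Or.inr (Or.inl h)

theorem finite_grlexLT {n : ℕ} (α : Fin n →₀ ℕ) : {β | GrlexLT β α}.Finite :=
  (finite_degree_le n α.degree).subset fun _ h => h.degree_le

theorem ncard_grlexLT_lt {n : ℕ} {α β : Fin n →₀ ℕ} (h : GrlexLT α β) :
    {γ | GrlexLT γ α}.ncard < {γ | GrlexLT γ β}.ncard := by
  refine Set.ncard_lt_ncard ⟨fun γ hγ => hγ.trans h, fun hsub => ?_⟩ (finite_grlexLT β)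
  exact GrlexLT.irrefl α (hsub h)

/-- Multisets of size `m` in `n + 1` letters inject into these exponents by forgetting the
multiplicity of the letter `0`, which the size recovers. -/
theorem choose_le_ncard_degree_le (n m : ℕ) :
    (n + m).choose m ≤ {α : Fin n →₀ ℕ | α.degree ≤ m}.ncard := by
  have hsum : ∀ s : Sym (Fin (n + 1)) m,
      (s : Multiset (Fin (n + 1))).count 0 + ∑ i : Fin n, (s : Multiset (Fin (n + 1))).count i.succ
        = m := by
    intro s
    rw [← Fin.sum_univ_succ fun i => (s : Multiset (Fin (n + 1))).count i,
      Multiset.sum_count_eq_card (fun _ _ => Finset.mem_univ _)]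
    exact s.2
  let f : Sym (Fin (n + 1)) m → (Fin n →₀ ℕ) := fun s =>
    Finsupp.equivFunOnFinite.symm fun i => (s : Multiset (Fin (n + 1))).count i.succ
  have hf : Function.Injective f := by
    intro s t h
    have h1 : ∀ i : Fin n, (s : Multiset (Fin (n + 1))).count i.succ =
        (t : Multiset (Fin (n + 1))).count i.succ := fun i => DFunLike.congr_fun h i
    apply Sym.ext
    ext i
    refine Fin.cases ?_ h1 i
    have hs := hsum s
    have ht := hsum t
    simp only [h1] at hs
    omega
  have hsub : Set.range f ⊆ {α : Fin n →₀ ℕ | α.degree ≤ m} := by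
    rintro _ ⟨s, rfl⟩
    have := hsum s
    simp only [Set.mem_ofPred_eq, Finsupp.degree_eq_sum, f, Finsupp.equivFunOnFinite_symm_apply_apply]
    omega
  have hcard := Set.ncard_le_ncard hsub (finite_degree_le n m)
  rw [← Set.image_univ, Set.ncard_image_of_injective _ hf, Set.ncard_univ, Nat.card_eq_fintype_card,
    Sym.card_sym_eq_choose, Fintype.card_fin] at hcard
  rwa [show n + m = n + 1 + m - 1 by omega]

theorem ncard_degree_le_le {n : ℕ} {m : ℕ} {α : Fin n →₀ ℕ} (h : m < α.degree) :
    {α : Fin n →₀ ℕ | α.degree ≤ m}.ncard ≤ {β | GrlexLT β α}.ncard :=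
  Set.ncard_le_ncard (fun _ hβ => Or.inl (lt_of_le_of_lt hβ h)) (finite_grlexLT α)

theorem degree_le_of_mem_B0 {n m r : ℕ} (hrN : r ≤ (n + m).choose m) {α : Fin n →₀ ℕ}
    (h : α ∈ B0 n r) : α.degree ≤ m := by
  by_contra hcon
  have h1 := ncard_degree_le_le (not_le.1 hcon)
  have h2 := choose_le_ncard_degree_le n m
  have h3 : {β | GrlexLT β α}.ncard < r := h
  omega

/-- The number of predecessors is an injective rank. On the exponents of degree at most `m`, which
form an initial segment, it takes each value below their number, so every rank below `r` occurs. -/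
theorem card_B0 {n m r : ℕ} (hrN : r ≤ (n + m).choose m) : Fintype.card (B0 n r) = r := by
  set D := (finite_degree_le n m).toFinset
  have hDcard : D.card = {α : Fin n →₀ ℕ | α.degree ≤ m}.ncard :=
    (Set.ncard_eq_toFinset_card _ _).symm
  let f : (Fin n →₀ ℕ) → ℕ := fun α => {β | GrlexLT β α}.ncard
  have hinj : Function.Injective f := by
    intro α β h
    by_contra hne
    rcases GrlexLT.trichotomy hne with h' | h'
    · exact (ncard_grlexLT_lt h').ne h
    · exact (ncard_grlexLT_lt h').ne' h
  have hmaps : ∀ α ∈ D, f α ∈ Finset.range D.card := by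
    intro α hα
    rw [Finset.mem_range, hDcard]
    refine Set.ncard_lt_ncard ⟨fun β hβ => ?_, fun hsub => ?_⟩ (finite_degree_le n m)
    · exact hβ.degree_le.trans (by simpa [D] using hα)
    · exact GrlexLT.irrefl α (hsub (by simpa [D] using hα))
  have himg : D.image f = Finset.range D.card := by
    refine Finset.eq_of_subset_of_card_le (Finset.image_subset_iff.2 hmaps) ?_
    rw [Finset.card_image_of_injective _ hinj, Finset.card_range]
  have hbij : f '' B0 n r = Set.Iio r := by
    ext k
    constructor
    · rintro ⟨α, hα, rfl⟩
      exact hα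
    · intro hk
      have : k ∈ Finset.range D.card := by
        rw [Finset.mem_range, hDcard]
        exact lt_of_lt_of_le hk (hrN.trans (choose_le_ncard_degree_le n m))
      rw [← himg, Finset.mem_image] at this
      obtain ⟨α, -, rfl⟩ := this
      exact ⟨α, hk, rfl⟩
  have := congrArg Set.ncard hbij
  rw [Set.ncard_image_of_injective _ hinj] at this
  rw [← Nat.card_eq_fintype_card, Nat.card_coe_set_eq, this, ← Nat.card_coe_set_eq]
  simp

theorem zero_mem_B0 {n r : ℕ} (hr : 0 < r) : (0 : Fin n →₀ ℕ) ∈ B0 n r := by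
  have : {β : Fin n →₀ ℕ | GrlexLT β 0} = ∅ := by
    rw [Set.eq_empty_iff_forall_notMem]
    intro β hβ
    have h0 : β = 0 := by
      have := hβ.degree_le
      rw [map_zero, Nat.le_zero, Finsupp.degree_eq_zero_iff] at this
      exact this
    subst h0
    exact GrlexLT.irrefl _ hβ
  change Set.ncard _ < r
  rwa [this, Set.ncard_empty]

/-- `𝔹₀` is an initial segment of a graded order. This is what bounds the degree of `φ[G, α]` by
`|α|`. -/
theorem degree_le_of_mem_B0_of_notMem {n r : ℕ} {α β : Fin n →₀ ℕ} (hβ : β ∈ B0 n r)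
    (hα : α ∉ B0 n r) : β.degree ≤ α.degree := by
  by_contra hcon
  exact hα ((ncard_grlexLT_lt (Or.inl (not_le.1 hcon) : GrlexLT α β)).trans hβ)

theorem finite_B1 (n r : ℕ) : (B1 n r).Finite := by
  refine ((finite_B0 n r).prod (Set.finite_univ (α := Fin n))).image
    (fun p => p.1 + Finsupp.single p.2 1) |>.subset ?_
  rintro α ⟨-, β, hβ, i, rfl⟩
  exact ⟨(β, i), ⟨hβ, trivial⟩, rfl⟩

noncomputable instance (n r : ℕ) : Fintype (B1 n r) := (finite_B1 n r).fintype

/-! ### Common zeros of generating polynomials -/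

section Zeros

variable {n r : ℕ}

/-- The value of the monomial `x^α` at `v`. -/
def monVal {S : Type*} [CommSemiring S] (v : Fin n → S) (α : Fin n →₀ ℕ) : S := ∏ i, v i ^ α i

theorem monVal_add_single {S : Type*} [CommSemiring S] (v : Fin n → S) (α : Fin n →₀ ℕ)
    (i : Fin n) : monVal v (α + Finsupp.single i 1) = monVal v α * v i := by
  classical
  simp only [monVal, Finsupp.add_apply, pow_add, Finset.prod_mul_distrib]
  congr 1
  rw [Finset.prod_eq_single i]
  · simp
  · intro b _ hb
    rw [Finsupp.single_eq_of_ne hb, pow_zero]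
  · simp

theorem eval_monomial_one (v : Fin n → ℂ) (α : Fin n →₀ ℕ) :
    eval v (monomial α (1 : ℂ)) = monVal v α := by
  rw [eval_monomial, one_mul, monVal, Finsupp.prod_fintype _ _ fun _ => pow_zero _]

theorem eval_phi (G : GMatrix n r) (α : B1 n r) (v : Fin n → ℂ) :
    eval v (phi G α) = ∑ β : B0 n r, monVal v β * G β α - monVal v α := by
  rw [phi, map_sub, eval_monomial_one, map_sum]
  congr 1
  refine Finset.sum_congr rfl fun β _ => ?_
  rw [← mul_one (G β α), ← C_mul_monomial, map_mul, eval_C, eval_monomial_one, mul_one, mul_comm]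

theorem mem_zeros_iff (G : GMatrix n r) (v : Fin n → ℂ) :
    v ∈ zeros G ↔ ∀ α : B1 n r, ∑ β : B0 n r, monVal v β * G β α = monVal v α := by
  simp only [zeros, Set.mem_ofPred_eq, eval_phi, sub_eq_zero]

theorem inD_iff (v : Fin r → Fin n → ℂ) :
    InD v ↔ LinearIndependent ℂ fun (j : Fin r) (β : B0 n r) => monVal (v j) β := by
  have : (fun (j : Fin r) (β : B0 n r) => β.1.prod fun i e => v j i ^ e) =
      fun (j : Fin r) (β : B0 n r) => monVal (v j) β := by
    ext j β
    rw [monVal, Finsupp.prod_fintype _ _ fun _ => pow_zero _]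
  rw [InD, this]

theorem InD.injective {v : Fin r → Fin n → ℂ} (h : InD v) : Function.Injective v := by
  intro j k hjk
  apply ((inD_iff v).1 h).injective
  simp only [hjk]

/-- At a zero of `φ[G]`, the vector of values of `𝔹₀` is a left eigenvector of `M_{x_i}(G)`. -/
theorem vecMul_companion {G : GMatrix n r} {v : Fin n → ℂ} (hv : v ∈ zeros G) (i : Fin n)
    (ν : B0 n r) :
    ∑ μ : B0 n r, monVal v μ * companion G i μ ν = v i * monVal v ν := by
  classical
  rw [mul_comm, ← monVal_add_single]
  by_cases h : ν.1 + Finsupp.single i 1 ∈ B0 n r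
  · rw [Finset.sum_eq_single ⟨_, h⟩]
    · simp [companion, h]
    · intro μ _ hμ
      have : μ.1 ≠ ν.1 + Finsupp.single i 1 := fun e => hμ (Subtype.ext e)
      simp [companion, h, this]
    · simp
  · simp only [companion, dif_neg h]
    exact (mem_zeros_iff G v).1 hv ⟨_, h, ν.1, ν.2, i, rfl⟩

theorem span_monVal_eq_top {v : Fin r → Fin n → ℂ} (hcard : Fintype.card (B0 n r) = r)
    (h : InD v) :
    Submodule.span ℂ (Set.range fun (j : Fin r) (β : B0 n r) => monVal (v j) β) = ⊤ := by
  apply LinearIndependent.span_eq_top_of_card_eq_finrank' ((inD_iff v).1 h)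
  simp [hcard]

/-- If `φ[G]` vanishes at `v₁, …, v_r` and `(v₁, …, v_r) ∈ D`, there are no other zeros. -/
theorem zeros_eq_range {G : GMatrix n r} {v : Fin r → Fin n → ℂ} (hr : 0 < r)
    (hcard : Fintype.card (B0 n r) = r) (h : InD v) (hv : ∀ j, v j ∈ zeros G) :
    zeros G = Set.range v := by
  refine Set.Subset.antisymm (fun w hw => ?_) (by rintro _ ⟨j, rfl⟩; exact hv j)
  have hmem : (fun β : B0 n r => monVal w β) ∈
      Submodule.span ℂ (Set.range fun (j : Fin r) (β : B0 n r) => monVal (v j) β) := by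
    rw [span_monVal_eq_top hcard h]; trivial
  obtain ⟨c, hc⟩ := (Submodule.mem_span_range_iff_exists_fun ℂ).1 hmem
  have hc' : ∀ β : B0 n r, ∑ j, c j * monVal (v j) β = monVal w β := by
    intro β
    have := congrFun hc β
    simpa using this
  -- The value vector at `w` is `∑ c_j` times those at the `v_j`. Applying `M_{x_i}(G)` multiplies
  -- it by `w_i` and the summands by `v_{j,i}`; compare coefficients.
  have hrel : ∀ i j, c j * (w i - v j i) = 0 := by
    intro i
    apply Fintype.linearIndependent_iff.1 ((inD_iff v).1 h)
    ext ν
    have h1 := vecMul_companion hw i ν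
    simp only [← hc', Finset.sum_mul] at h1
    rw [Finset.sum_comm] at h1
    simp only [mul_assoc, ← Finset.mul_sum, fun j => vecMul_companion (hv j) i ν] at h1
    simp only [Finset.sum_apply, Pi.smul_apply, smul_eq_mul, Pi.zero_apply]
    rw [Finset.mul_sum] at h1
    rw [← sub_eq_zero, ← Finset.sum_sub_distrib] at h1
    rw [← neg_eq_zero, ← Finset.sum_neg_distrib, ← h1]
    exact Finset.sum_congr rfl fun j _ => by ring
  -- The monomial `1` belongs to `𝔹₀`, so the value vector at `w` is not zero.
  have hex : ∃ j, c j ≠ 0 := by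
    by_contra! hcon
    have := hc' ⟨0, zero_mem_B0 hr⟩
    simp [hcon, monVal] at this
  obtain ⟨j, hj⟩ := hex
  refine ⟨j, funext fun i => ?_⟩
  exact (sub_eq_zero.1 ((mul_eq_zero.1 (hrel i j)).resolve_left hj)).symm

/-- The value vectors at the `v_k` form a basis of common left eigenvectors. -/
theorem companion_commute {G : GMatrix n r} {v : Fin r → Fin n → ℂ}
    (hcard : Fintype.card (B0 n r) = r) (h : InD v) (hv : ∀ j, v j ∈ zeros G) (i j : Fin n) :
    companion G i * companion G j = companion G j * companion G i := by
  classical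
  have hvm : ∀ k l, Matrix.vecMul (fun β : B0 n r => monVal (v k) β) (companion G l) =
      v k l • fun β : B0 n r => monVal (v k) β := by
    intro k l
    ext ν
    simpa [Matrix.vecMul, dotProduct] using vecMul_companion (hv k) l ν
  have hlin : Matrix.toLinearMapRight' (companion G i * companion G j) =
      Matrix.toLinearMapRight' (companion G j * companion G i) := by
    refine LinearMap.ext_on (span_monVal_eq_top hcard h) ?_
    rintro _ ⟨k, rfl⟩
    simp only [Matrix.toLinearMapRight'_apply, ← Matrix.vecMul_vecMul, hvm, Matrix.smul_vecMul,
      smul_smul, mul_comm]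
  exact Matrix.toLinearMapRight'.injective hlin

theorem encard_range_of_injective {v : Fin r → Fin n → ℂ} (h : Function.Injective v) :
    (Set.range v).encard = r := by
  rw [← Set.image_univ, h.encard_image, Set.encard_univ]
  simp

theorem nondefective_of_inD {G : GMatrix n r} {v : Fin r → Fin n → ℂ} (hr : 0 < r)
    (hcard : Fintype.card (B0 n r) = r) (h : InD v) (hv : ∀ j, v j ∈ zeros G) :
    Nondefective G := by
  rw [Nondefective, zeros_eq_range hr hcard h hv, encard_range_of_injective h.injective]

/-- A column of `G` is a linear functional on `ℂ^{𝔹₀}` whose values on the spanning value vectors at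
the `v_j` are prescribed. -/
theorem generatingMatrix_unique {G G' : GMatrix n r} {v : Fin r → Fin n → ℂ}
    (hcard : Fintype.card (B0 n r) = r) (h : InD v) (hv : ∀ j, v j ∈ zeros G)
    (hv' : ∀ j, v j ∈ zeros G') : G = G' := by
  classical
  have hdual : ∀ α : B1 n r, (fun β => G β α - G' β α) = 0 := by
    intro α
    let L : (B0 n r → ℂ) →ₗ[ℂ] ℂ :=
      ∑ β : B0 n r, (G β α - G' β α) • LinearMap.proj β
    have hL : L = 0 := by
      refine LinearMap.ext_on (span_monVal_eq_top hcard h) ?_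
      rintro _ ⟨j, rfl⟩
      have h1 := (mem_zeros_iff G (v j)).1 (hv j) α
      have h2 := (mem_zeros_iff G' (v j)).1 (hv' j) α
      simp only [L, LinearMap.sum_apply, LinearMap.smul_apply, LinearMap.proj_apply, smul_eq_mul,
        LinearMap.zero_apply, sub_mul, Finset.sum_sub_distrib]
      simp only [mul_comm (G _ _), mul_comm (G' _ _), h1, h2, sub_self]
    ext β
    have := congrArg (fun L => L (Pi.single β 1)) hL
    simpa [L, Pi.single_apply] using this
  ext β α
  exact sub_eq_zero.1 (congrFun (hdual α) β)

/-! ### Reduction modulo generating polynomials -/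

/-- The multiples `x^γ φ[G, α]` with `|α| + |γ| ≤ D` and the monomials of `𝔹₀` of degree at most `D`
span a space of polynomials. -/
noncomputable def reductionSpace (G : GMatrix n r) (D : ℕ) : Submodule ℂ (MvPolynomial (Fin n) ℂ) :=
  Submodule.span ℂ ({p | ∃ (α : B1 n r) (γ : Fin n →₀ ℕ), α.1.degree + γ.degree ≤ D ∧
      p = phi G α * monomial γ 1} ∪
    {p | ∃ β : B0 n r, β.1.degree ≤ D ∧ p = monomial β.1 1})

theorem reductionSpace_mono (G : GMatrix n r) {D E : ℕ} (h : D ≤ E) :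
    reductionSpace G D ≤ reductionSpace G E := by
  apply Submodule.span_mono
  rintro p (⟨α, γ, hD, rfl⟩ | ⟨β, hD, rfl⟩)
  · exact Or.inl ⟨α, γ, hD.trans h, rfl⟩
  · exact Or.inr ⟨β, hD.trans h, rfl⟩

theorem monomial_one_eq_sub_phi (G : GMatrix n r) (α : B1 n r) :
    monomial α.1 (1 : ℂ) = ∑ β : B0 n r, G β α • monomial β.1 1 - phi G α * monomial 0 1 := by
  have : (monomial (0 : Fin n →₀ ℕ) (1 : ℂ)) = 1 := rfl
  rw [this, mul_one, phi]
  simp [smul_monomial]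

/-- `x_i` takes a monomial of `𝔹₀` to `𝔹₀` or to `𝔹₁`. In the second case `φ[G, α]` rewrites it by
monomials of `𝔹₀` of no larger degree, so the degree bound grows only by one. -/
theorem mul_X_mem_reductionSpace (G : GMatrix n r) {D : ℕ} {p : MvPolynomial (Fin n) ℂ}
    (hp : p ∈ reductionSpace G D) (i : Fin n) :
    p * monomial (Finsupp.single i 1) 1 ∈ reductionSpace G (D + 1) := by
  induction hp using Submodule.span_induction with
  | mem p hp =>
    rcases hp with ⟨α, γ, hD, rfl⟩ | ⟨β, hD, rfl⟩
    · refine Submodule.subset_span (Or.inl ⟨α, γ + Finsupp.single i 1, ?_, ?_⟩)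
      · rw [map_add, Finsupp.degree_single]; omega
      · rw [mul_assoc, monomial_mul, one_mul]
    · rw [monomial_mul, one_mul]
      have hdeg : (β.1 + Finsupp.single i 1).degree ≤ D + 1 := by
        rw [map_add, Finsupp.degree_single]; omega
      by_cases h : β.1 + Finsupp.single i 1 ∈ B0 n r
      · exact Submodule.subset_span (Or.inr ⟨⟨_, h⟩, hdeg, rfl⟩)
      · rw [monomial_one_eq_sub_phi G ⟨_, h, β.1, β.2, i, rfl⟩]
        refine Submodule.sub_mem _ (Submodule.sum_mem _ fun β' _ => Submodule.smul_mem _ _ ?_) ?_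
        · exact Submodule.subset_span
            (Or.inr ⟨β', (degree_le_of_mem_B0_of_notMem β'.2 h).trans hdeg, rfl⟩)
        · exact Submodule.subset_span (Or.inl ⟨_, 0, by simpa using hdeg, rfl⟩)
  | zero => simp
  | add p q _ _ hp hq => rw [add_mul]; exact Submodule.add_mem _ hp hq
  | smul c p _ hp => rw [smul_mul_assoc]; exact Submodule.smul_mem _ _ hp

theorem monomial_mem_reductionSpace (hr : 0 < r) (G : GMatrix n r) (D : ℕ) :
    ∀ δ : Fin n →₀ ℕ, δ.degree ≤ D → monomial δ (1 : ℂ) ∈ reductionSpace G D := by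
  induction D with
  | zero =>
    intro δ hδ
    rw [Nat.le_zero, Finsupp.degree_eq_zero_iff] at hδ
    subst hδ
    exact Submodule.subset_span (Or.inr ⟨⟨0, zero_mem_B0 hr⟩, by simp, rfl⟩)
  | succ D ih =>
    intro δ hδ
    by_cases h0 : δ = 0
    · subst h0
      exact reductionSpace_mono G (Nat.zero_le _)
        (Submodule.subset_span (Or.inr ⟨⟨0, zero_mem_B0 hr⟩, by simp, rfl⟩))
    · obtain ⟨i, hi⟩ := Finsupp.ne_iff.1 h0
      have hle : Finsupp.single i 1 ≤ δ := by
        rw [Finsupp.single_le_iff]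
        exact Nat.one_le_iff_ne_zero.2 hi
      have hδ' : δ - Finsupp.single i 1 + Finsupp.single i 1 = δ := tsub_add_cancel_of_le hle
      have hd := congrArg Finsupp.degree hδ'
      rw [map_add, Finsupp.degree_single] at hd
      have := mul_X_mem_reductionSpace G (ih (δ - Finsupp.single i 1) (by omega)) i
      rwa [monomial_mul, one_mul, hδ'] at this

/-- The values of the monomials of `𝔹₀` at `r` distinct zeros of `φ[G]` are linearly independent. -/
theorem inD_of_injective {G : GMatrix n r} {v : Fin r → Fin n → ℂ} (hr : 0 < r)
    (hinj : Function.Injective v) (hv : ∀ j, v j ∈ zeros G) : InD v := by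
  classical
  rw [inD_iff, Fintype.linearIndependent_iff]
  intro g hg j₀
  -- The assumed relation says that `E` kills `𝔹₀`. It also kills all multiples of the `φ[G, α]`,
  -- hence every polynomial.
  let E : MvPolynomial (Fin n) ℂ →ₗ[ℂ] ℂ := ∑ j, g j • (aeval (v j)).toLinearMap
  have hE : ∀ p, E p = ∑ j, g j * eval (v j) p := by
    intro p
    simp [E, LinearMap.sum_apply, aeval_eq_eval]
  have hzero : ∀ D, ∀ p ∈ reductionSpace G D, E p = 0 := by
    intro D p hp
    induction hp using Submodule.span_induction with
    | mem p hp =>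
      rcases hp with ⟨α, γ, -, rfl⟩ | ⟨β, -, rfl⟩
      · rw [hE]
        exact Finset.sum_eq_zero fun j _ => by rw [map_mul, hv j α]; ring
      · rw [hE]
        simp only [eval_monomial_one]
        simpa using congrFun hg β
    | zero => exact map_zero E
    | add p q _ _ hp hq => rw [map_add, hp, hq, add_zero]
    | smul c p _ hp => rw [map_smul, hp, smul_zero]
  have hE0 : E = 0 := by
    refine (basisMonomials (Fin n) ℂ).ext fun δ => ?_
    rw [coe_basisMonomials]
    exact hzero δ.degree _ (monomial_mem_reductionSpace hr G _ δ le_rfl)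
  have hex : ∀ k, k ≠ j₀ → ∃ i, v k i ≠ v j₀ i := fun k hk =>
    Function.ne_iff.1 (hinj.ne hk)
  choose i hi using hex
  -- `q` vanishes at every `v_k` except `v_{j₀}`, so `E q = 0` isolates the coefficient `g j₀`.
  let q : MvPolynomial (Fin n) ℂ :=
    ∏ k, if hk : k ≠ j₀ then X (i k hk) - C (v k (i k hk)) else 1
  have h1 : E q = g j₀ * eval (v j₀) q := by
    rw [hE, Finset.sum_eq_single j₀]
    · intro j _ hj
      rw [map_prod, Finset.prod_eq_zero (Finset.mem_univ j) (by simp [hj]), mul_zero]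
    · simp
  rw [hE0, LinearMap.zero_apply] at h1
  refine (mul_eq_zero.1 h1.symm).resolve_right ?_
  rw [map_prod]
  refine Finset.prod_ne_zero_iff.2 fun k _ => ?_
  by_cases hk : k ≠ j₀
  · simpa [hk, sub_eq_zero] using (hi k hk).symm
  · simp [hk]

end Zeros

/-! ### Weighted sums of powers -/

section Tensors

variable {n m r : ℕ}

/-- The exponent `α` with `x_{i₁}⋯x_{i_m} = x^α`, where `x₀ = 1`. -/
noncomputable def content (i : Fin m → Fin (n + 1)) : Fin n →₀ ℕ :=
  Finsupp.equivFunOnFinite.symm fun j => Nat.card {k // i k = j.succ}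

theorem prod_cons_one {S : Type*} [CommSemiring S] (v : Fin n → S) (i : Fin m → Fin (n + 1)) :
    ∏ k, (Fin.cons 1 v : Fin (n + 1) → S) (i k) = monVal v (content i) := by
  classical
  rw [Finset.prod_comp (Fin.cons 1 v : Fin (n + 1) → S) i,
    Finset.prod_subset (Finset.subset_univ _), Fin.prod_univ_succ]
  · simp only [Fin.cons_zero, one_pow, Fin.cons_succ, one_mul]
    refine Finset.prod_congr rfl fun j _ => ?_
    congr 1
    simp [content, Nat.card_eq_fintype_card, Fintype.card_subtype]
  · intro c _ hc
    have : Finset.univ.filter (fun k => i k = c) = ∅ := by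
      rw [Finset.filter_eq_empty_iff]
      intro k _ hk
      exact hc (Finset.mem_image.2 ⟨k, Finset.mem_univ _, hk⟩)
    simp [this]

theorem content_surjective {α : Fin n →₀ ℕ} (h : α.degree ≤ m) :
    ∃ i : Fin m → Fin (n + 1), content i = α := by
  -- The exponent is padded to total degree `m` by copies of the index `0`.
  let a : Fin (n + 1) → ℕ := Fin.cons (m - α.degree) α
  have hcard : Fintype.card (Σ c, Fin (a c)) = m := by
    rw [Fintype.card_sigma, Fin.sum_univ_succ]
    simp only [Fintype.card_fin, a, Fin.cons_zero, Fin.cons_succ]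
    rw [← Finsupp.degree_eq_sum]
    omega
  let e : Fin m ≃ Σ c, Fin (a c) := (Fintype.equivFinOfCardEq hcard).symm
  refine ⟨fun k => (e k).1, ?_⟩
  ext j
  have e' : {k // (e k).1 = j.succ} ≃ Fin (a j.succ) :=
    (e.subtypeEquiv fun k => Iff.rfl).trans (Equiv.sigmaSubtype j.succ)
  have h1 := Nat.card_congr e'
  rw [Nat.card_fin] at h1
  exact h1

theorem degree_content_le (i : Fin m → Fin (n + 1)) : (content i).degree ≤ m := by
  classical
  rw [Finsupp.degree_eq_sum]
  have h : ∑ c, (Finset.univ.filter fun k => i k = c).card = m := by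
    rw [← Finset.card_eq_sum_card_fiberwise (fun _ _ => Finset.mem_univ _)]
    simp
  rw [Fin.sum_univ_succ] at h
  simp only [content, Finsupp.equivFunOnFinite_symm_apply_apply, Nat.card_eq_fintype_card,
    Fintype.card_subtype]
  omega

/-- The tensor `∑ λ_j (1, v_j)^{⊗m}` for `x_j = (λ_j, v_j)`, over any commutative ring. -/
noncomputable def wsum {S : Type*} [CommSemiring S] (m : ℕ) (x : Fin r → Fin (n + 1) → S) :
    (Fin m → Fin (n + 1)) → S :=
  fun i => ∑ j, x j 0 * monVal (Fin.tail (x j)) (content i)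

theorem tensorPow_homog (v : Fin n → ℂ) (i : Fin m → Fin (n + 1)) :
    tensorPow m (homog v) i = monVal v (content i) :=
  prod_cons_one v i

theorem sum_smul_tensorPow (lam : Fin r → ℂ) (v : Fin r → Fin n → ℂ) :
    ∑ j, lam j • tensorPow m (homog (v j)) =
      wsum m fun j => (Fin.cons (lam j) (v j) : Fin (n + 1) → ℂ) := by
  ext i
  simp [wsum, Finset.sum_apply, tensorPow_homog]

theorem wsum_eq (x : Fin r → Fin (n + 1) → ℂ) :
    wsum m x = ∑ j, x j 0 • tensorPow m (homog (Fin.tail (x j))) := by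
  rw [sum_smul_tensorPow]
  simp

theorem entry_wsum (x : Fin r → Fin (n + 1) → ℂ) {α : Fin n →₀ ℕ} (h : α.degree ≤ m) :
    entry (wsum m x) α = ∑ j, x j 0 * monVal (Fin.tail (x j)) α := by
  obtain ⟨i, hi⟩ := content_surjective h
  have hex : ∃ i : Fin m → Fin (n + 1), ∀ j : Fin n, Nat.card {k // i k = j.succ} = α j :=
    ⟨i, fun j => DFunLike.congr_fun hi j⟩
  rw [entry, dif_pos hex]
  have : content hex.choose = α := by
    ext j
    exact hex.choose_spec j
  rw [wsum, this]

theorem wsum_eq_entry (x : Fin r → Fin (n + 1) → ℂ) (i : Fin m → Fin (n + 1)) :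
    wsum m x i = entry (wsum m x) (content i) := by
  rw [entry_wsum x (degree_content_le i)]
  rfl

theorem pairing_eq_constr (p : MvPolynomial (Fin n) ℂ) (F : Tensor n m) :
    pairing p F = (basisMonomials (Fin n) ℂ).constr ℂ (entry F) p := by
  conv_rhs => rw [p.as_sum]
  rw [map_sum, pairing]
  refine Finset.sum_congr rfl fun α _ => ?_
  have : monomial α (coeff α p) = coeff α p • basisMonomials (Fin n) ℂ α := by
    rw [coe_basisMonomials, smul_monomial, smul_eq_mul, mul_one]
  rw [this, map_smul, Module.Basis.constr_basis, smul_eq_mul]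

/-- The degree bound matters: beyond degree `m`, `entry` has the default value `0` and no longer is
a combination of evaluations. -/
theorem pairing_wsum (x : Fin r → Fin (n + 1) → ℂ) {p : MvPolynomial (Fin n) ℂ}
    (hp : p.totalDegree ≤ m) :
    pairing p (wsum m x) = ∑ j, x j 0 * eval (Fin.tail (x j)) p := by
  have h1 : ∀ α ∈ p.support, p.coeff α * entry (wsum m x) α =
      ∑ j, x j 0 * (p.coeff α * monVal (Fin.tail (x j)) α) := by
    intro α hα
    have : α.degree ≤ m := (le_totalDegree hα).trans hp
    rw [entry_wsum x this, Finset.mul_sum]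
    exact Finset.sum_congr rfl fun j _ => by ring
  rw [pairing, Finset.sum_congr rfl h1, Finset.sum_comm]
  refine Finset.sum_congr rfl fun j _ => ?_
  rw [← Finset.mul_sum, eval_eq']
  rfl

theorem totalDegree_phi_le (G : GMatrix n r) (α : B1 n r) :
    (phi G α).totalDegree ≤ α.1.degree := by
  refine (totalDegree_sub _ _).trans (max_le ?_ ?_)
  · refine (totalDegree_finsetSum _ _).trans (Finset.sup_le fun β _ => ?_)
    exact (totalDegree_monomial_le _ _).trans (degree_le_of_mem_B0_of_notMem β.2 α.2.1)
  · exact totalDegree_monomial_le _ _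

theorem mem_generatingMatrices (x : Fin r → Fin (n + 1) → ℂ) {G : GMatrix n r}
    (hG : ∀ j, Fin.tail (x j) ∈ zeros G) : G ∈ generatingMatrices r (wsum m x) := by
  intro α γ hdeg
  rw [pairing_wsum]
  · refine Finset.sum_eq_zero fun j _ => ?_
    rw [map_mul, hG j α, zero_mul, mul_zero]
  · refine (totalDegree_mul _ _).trans (le_trans (add_le_add (totalDegree_phi_le G α) ?_) hdeg)
    exact totalDegree_monomial_le _ _

theorem exists_invertible_eval {v : Fin r → Fin n → ℂ} (hcard : Fintype.card (B0 n r) = r)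
    (h : InD v) (f : B0 n r → ℂ) :
    ∃! lam : Fin r → ℂ, ∀ β : B0 n r, ∑ j, lam j * monVal (v j) β = f β := by
  have hmem : f ∈
      Submodule.span ℂ (Set.range fun (j : Fin r) (β : B0 n r) => monVal (v j) β) := by
    rw [span_monVal_eq_top hcard h]; trivial
  obtain ⟨c, hc⟩ := (Submodule.mem_span_range_iff_exists_fun ℂ).1 hmem
  have hc' : ∀ β : B0 n r, ∑ j, c j * monVal (v j) β = f β := by
    intro β
    simpa using congrFun hc β
  refine ⟨c, hc', fun c' h' => ?_⟩
  have := Fintype.linearIndependent_iff.1 ((inD_iff v).1 h) (fun j => c' j - c j) (by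
    ext β
    simp only [Finset.sum_apply, Pi.smul_apply, smul_eq_mul, Pi.zero_apply, sub_mul,
      Finset.sum_sub_distrib, h' β, hc' β, sub_self])
  ext j
  exact sub_eq_zero.1 (this j)

/-- A tensor with a generating matrix `G` is a combination of the powers given by the zeros
of `φ[G]`. -/
theorem exists_decomposition {s : ℕ} (hr : 0 < r) (hrN : r ≤ (n + m).choose m)
    (y : Fin s → Fin (n + 1) → ℂ) {G : GMatrix n r}
    (hG : G ∈ generatingMatrices r (wsum m y)) {v : Fin r → Fin n → ℂ} (hD : InD v)
    (hv : ∀ j, v j ∈ zeros G) :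
    ∃ lam : Fin r → ℂ, wsum m y = ∑ j, lam j • tensorPow m (homog (v j)) := by
  obtain ⟨lam, hlam, -⟩ := exists_invertible_eval (card_B0 hrN) hD
    (fun β => entry (wsum m y) β)
  refine ⟨lam, ?_⟩
  let E : MvPolynomial (Fin n) ℂ →ₗ[ℂ] ℂ := ∑ j, lam j • (aeval (v j)).toLinearMap
  have hE : ∀ p, E p = ∑ j, lam j * eval (v j) p := by
    intro p
    simp [E, LinearMap.sum_apply, aeval_eq_eval]
  -- Both functionals kill the admissible multiples of `φ[G, α]`, and `lam` was chosen to make them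
  -- agree on `𝔹₀`. Since these span all monomials of degree at most `m`, every entry of the tensor
  -- agrees.
  have key : ∀ p ∈ reductionSpace G m, pairing p (wsum m y) = E p := by
    intro p hp
    induction hp using Submodule.span_induction with
    | mem p hp =>
      rcases hp with ⟨α, γ, hdeg, rfl⟩ | ⟨β, -, rfl⟩
      · rw [hG α γ hdeg, hE]
        exact (Finset.sum_eq_zero fun j _ => by rw [map_mul, hv j α]; ring).symm
      · rw [hE]
        simp only [eval_monomial_one]
        rw [hlam, pairing_eq_constr]
        have : monomial β.1 (1 : ℂ) = basisMonomials (Fin n) ℂ β := by rw [coe_basisMonomials]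
        rw [this, Module.Basis.constr_basis]
    | zero => simp [pairing_eq_constr]
    | add p q _ _ hp hq =>
      rw [map_add, ← hp, ← hq]
      simp only [pairing_eq_constr, map_add]
    | smul c p _ hp =>
      rw [map_smul, ← hp]
      simp only [pairing_eq_constr, map_smul]
  rw [sum_smul_tensorPow]
  ext i
  rw [wsum_eq_entry]
  have h1 := key _ (monomial_mem_reductionSpace hr G m _ (degree_content_le i))
  rw [pairing_eq_constr, hE] at h1
  have : monomial (content i) (1 : ℂ) = basisMonomials (Fin n) ℂ (content i) := by
    rw [coe_basisMonomials]
  simp only [eval_monomial_one] at h1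
  rw [this, Module.Basis.constr_basis] at h1
  simpa [wsum] using h1

/-- The entries of the tensor at the exponents in `𝔹₀` already form an invertible linear system for
the coefficients. -/
theorem coefficients_unique (hrN : r ≤ (n + m).choose m) {v : Fin r → Fin n → ℂ} (hD : InD v)
    {lam lam' : Fin r → ℂ}
    (h : ∑ j, lam j • tensorPow m (homog (v j)) = ∑ j, lam' j • tensorPow m (homog (v j))) :
    lam = lam' := by
  have h1 : ∀ β : B0 n r, ∑ j, lam j * monVal (v j) β = ∑ j, lam' j * monVal (v j) β := by
    intro β
    rw [sum_smul_tensorPow, sum_smul_tensorPow] at h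
    have := congrArg (fun F => entry F β.1) h
    simp only [entry_wsum _ (degree_le_of_mem_B0 hrN β.2)] at this
    simpa using this
  exact (exists_invertible_eval (card_B0 hrN) hD _).unique (fun β => rfl) (fun β => (h1 β).symm)

end Tensors

/-! ### Generic linear slices -/

section GenericSlice

variable {A S₀ ι : Type} [CommRing A] [IsDomain A] [Infinite A] [CommRing S₀] [IsDomain S₀]
  [Algebra A S₀] [Fintype ι] {d : ℕ}

/-- The generic linear forms `∑ X_{k,p} g_p`, preceded by their coefficients. -/
noncomputable def genericForms (d : ℕ) (g : ι → S₀) :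
    (Fin d × ι) ⊕ Fin d → MvPolynomial (Fin d × ι) S₀ :=
  Sum.elim X fun k => ∑ p, X (k, p) * C (g p)

/-- At the coefficient point `e` the forms become the independent elements `g (E k)`. A relation `Q`
that is nonzero at some coefficient point `c` restricts to a nonzero relation on the line from `e`
to `c`; removing its factors of the line parameter and setting the parameter to `0` gives a
nontrivial relation among the `g (E k)`. So `Q` vanishes at all `c`. -/
theorem algebraicIndependent_genericForms [FaithfulSMul A S₀] {g : ι → S₀} {E : Fin d → ι}
    (hE : AlgebraicIndependent A fun k => g (E k)) :
    AlgebraicIndependent A (genericForms d g) := by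
  classical
  rw [AlgebraicIndependent, injective_iff_map_eq_zero]
  intro Q hQ
  have hclaim : ∀ c : Fin d × ι → A,
      (aeval (Sum.elim (fun s => C (c s)) X) Q : MvPolynomial (Fin d) A) = 0 := by
    intro c
    let e : Fin d × ι → A := fun s => if s.2 = E s.1 then 1 else 0
    -- the specialization of `Q` along the line through `e` and `c`
    let line : (Fin d × ι) ⊕ Fin d → Polynomial (MvPolynomial (Fin d) A) :=
      Sum.elim (fun s => Polynomial.C (C (e s)) + Polynomial.X * Polynomial.C (C (c s - e s)))
        fun k => Polynomial.C (X k)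
    let Pol : Polynomial (MvPolynomial (Fin d) A) := aeval line Q
    have h1 : (aeval (Sum.elim (fun s => C (c s)) X) Q : MvPolynomial (Fin d) A) =
        Pol.eval 1 := by
      have : (aeval (Sum.elim (fun s => C (c s)) X) : _ →ₐ[A] MvPolynomial (Fin d) A) =
          ((Polynomial.aeval (1 : MvPolynomial (Fin d) A)).restrictScalars A).comp
            (aeval line) := by
        ext s : 1
        rcases s with s | k
        · simp [line]
        · simp [line]
      rw [this]
      simp [Pol]
    rw [h1]
    by_contra hne
    have hPol : Pol ≠ 0 := by
      intro h
      rw [h] at hne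
      simp at hne
    -- `Pol` itself may vanish at the parameter `0`; the cofactor `q` of the highest power of the
    -- parameter does not.
    obtain ⟨q, hq, hndvd⟩ := Pol.exists_eq_pow_rootMultiplicity_mul_and_not_dvd hPol 0
    rw [Polynomial.C_0, sub_zero] at hq hndvd
    rw [Polynomial.X_dvd_iff] at hndvd
    let y : Fin d → Polynomial S₀ := fun k => Polynomial.C (g (E k)) +
      Polynomial.X * ∑ p, Polynomial.C (algebraMap A S₀ (c (k, p) - e (k, p)) * g p)
    let Θ : Polynomial (MvPolynomial (Fin d) A) →+* Polynomial S₀ :=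
      Polynomial.eval₂RingHom (aeval y : MvPolynomial (Fin d) A →ₐ[A] Polynomial S₀).toRingHom
        Polynomial.X
    have h2 : Θ Pol = 0 := by
      let Ψ : MvPolynomial (Fin d × ι) S₀ →+* Polynomial S₀ :=
        eval₂Hom Polynomial.C fun s => Polynomial.C (algebraMap A S₀ (e s)) +
          Polynomial.X * Polynomial.C (algebraMap A S₀ (c s - e s))
      have hcomp : Θ.comp (aeval line : _ →ₐ[A] _).toRingHom =
          Ψ.comp (aeval (genericForms d g) : _ →ₐ[A] _).toRingHom := by
        apply MvPolynomial.ringHom_ext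
        · intro a
          simp [Θ, Ψ, MvPolynomial.algebraMap_eq, Polynomial.algebraMap_eq,
            IsScalarTower.algebraMap_apply A S₀ (Polynomial S₀),
            IsScalarTower.algebraMap_apply A S₀ (MvPolynomial (Fin d × ι) S₀),
            IsScalarTower.algebraMap_apply A (MvPolynomial (Fin d) A)
              (Polynomial (MvPolynomial (Fin d) A))]
        · rintro (s | k)
          · simp [Θ, Ψ, line, genericForms, IsScalarTower.algebraMap_apply A S₀ (Polynomial S₀)]
          · have : ∑ p, Polynomial.C (algebraMap A S₀ (e (k, p))) * Polynomial.C (g p) =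
                Polynomial.C (g (E k)) := by
              rw [Finset.sum_eq_single (E k)]
              · simp [e]
              · intro p _ hp
                simp [e, hp]
              · simp
            simp [Θ, Ψ, line, genericForms, y, add_mul, Finset.sum_add_distrib, this,
              Finset.mul_sum, mul_assoc]
      have := RingHom.congr_fun hcomp Q
      simp only [RingHom.comp_apply] at this
      change Θ Pol = Ψ (aeval (genericForms d g) Q) at this
      rw [this, hQ, map_zero]
    rw [hq, map_mul, map_pow] at h2
    have hX : Θ Polynomial.X = Polynomial.X := by simp [Θ]
    rw [hX] at h2
    have h3 : Θ q = 0 := (mul_eq_zero.1 h2).resolve_left (pow_ne_zero _ Polynomial.X_ne_zero)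
    have h4 : (aeval fun k => g (E k)) (q.coeff 0) = 0 := by
      have h5 : (Polynomial.evalRingHom (0 : S₀)).comp Θ =
          (aeval (fun k => g (E k)) : MvPolynomial (Fin d) A →ₐ[A] S₀).toRingHom.comp
            (Polynomial.evalRingHom 0) := by
        apply Polynomial.ringHom_ext'
        · apply MvPolynomial.ringHom_ext
          · intro a
            simp [Θ, IsScalarTower.algebraMap_apply A S₀ (Polynomial S₀)]
          · intro k
            simp [Θ, y]
        · simp [Θ]
      have := RingHom.congr_fun h5 q
      simp only [RingHom.comp_apply, h3, map_zero] at this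
      rw [Polynomial.coeff_zero_eq_eval_zero]
      exact this.symm
    exact hndvd ((injective_iff_map_eq_zero _).1 hE _ h4)
  -- `Q` is now a polynomial in the coefficients of the forms which vanishes on the grid of
  -- constants, an infinite set in each coordinate because `A` is infinite.
  apply (sumAlgEquiv A (Fin d × ι) (Fin d)).injective
  rw [map_zero]
  refine funext_set (fun _ => Set.range (C : A → MvPolynomial (Fin d) A))
    (fun _ => Set.infinite_range_of_injective (C_injective _ _)) fun x hx => ?_
  choose c hc using fun s => hx s trivial
  have h6 : (eval x).comp (sumAlgEquiv A (Fin d × ι) (Fin d)).toRingEquiv.toRingHom =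
      (aeval (Sum.elim (fun s => C (c s)) X) : _ →ₐ[A] MvPolynomial (Fin d) A).toRingHom := by
    apply MvPolynomial.ringHom_ext
    · intro a
      simp [MvPolynomial.algebraMap_eq]
    · rintro (s | k)
      · simp [hc]
      · simp
  have := RingHom.congr_fun h6 Q
  rw [map_zero]
  exact this.trans (hclaim c)

/-- The independent family has as many members as the transcendence degree: `d` for `S₀` over `A`,
plus one for each coefficient. -/
theorem isTranscendenceBasis_genericForms [FaithfulSMul A S₀] {g : ι → S₀} {E : Fin d → ι}
    (hE : IsTranscendenceBasis A fun k => g (E k)) :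
    IsTranscendenceBasis A (genericForms d g) := by
  apply (algebraicIndependent_genericForms hE.1).isTranscendenceBasis_of_trdeg_le_of_finite
  have h1 := trdeg_add_eq A S₀ (A := MvPolynomial (Fin d × ι) S₀)
  rw [← h1, ← hE.cardinalMk_eq_trdeg, trdeg_of_isDomain]
  simp [add_comm]

end GenericSlice

/-! ### The generic weighted sum of powers -/

section Generic

variable {n m r : ℕ}

theorem map_monVal {S T F : Type*} [CommSemiring S] [CommSemiring T] [FunLike F S T]
    [RingHomClass F S T] (ψ : F) (v : Fin n → S) (α : Fin n →₀ ℕ) :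
    ψ (monVal v α) = monVal (fun i => ψ (v i)) α := by
  simp [monVal, map_prod, map_pow]

theorem map_wsum {S T F : Type*} [CommSemiring S] [CommSemiring T] [FunLike F S T]
    [RingHomClass F S T] (ψ : F) (x : Fin r → Fin (n + 1) → S) (i : Fin m → Fin (n + 1)) :
    ψ (wsum m x i) = wsum m (fun j c => ψ (x j c)) i := by
  simp only [wsum, map_sum, map_mul, map_monVal]
  rfl

/-- The square matrix of values of the monomials of `𝔹₀`. -/
def vand {S : Type*} [CommSemiring S] (e : B0 n r ≃ Fin r) (x : Fin r → Fin (n + 1) → S) :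
    Matrix (B0 n r) (B0 n r) S :=
  Matrix.of fun μ β => monVal (Fin.tail (x (e μ))) β

/-- The matrix of values of the monomials of `𝔹₁`. -/
def wand {S : Type*} [CommSemiring S] (e : B0 n r ≃ Fin r) (x : Fin r → Fin (n + 1) → S) :
    Matrix (B0 n r) (B1 n r) S :=
  Matrix.of fun μ α => monVal (Fin.tail (x (e μ))) α

theorem vand_map {S T : Type*} [CommSemiring S] [CommSemiring T] (ψ : S →+* T)
    (e : B0 n r ≃ Fin r) (x : Fin r → Fin (n + 1) → S) :
    (vand e x).map ψ = vand e fun j c => ψ (x j c) := by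
  ext μ β
  simp only [Matrix.map_apply, vand, Matrix.of_apply, map_monVal]
  rfl

theorem wand_map {S T : Type*} [CommSemiring S] [CommSemiring T] (ψ : S →+* T)
    (e : B0 n r ≃ Fin r) (x : Fin r → Fin (n + 1) → S) :
    (wand e x).map ψ = wand e fun j c => ψ (x j c) := by
  ext μ β
  simp only [Matrix.map_apply, wand, Matrix.of_apply, map_monVal]
  rfl

open Classical in
theorem inD_iff_det (e : B0 n r ≃ Fin r) (x : Fin r → Fin (n + 1) → ℂ) :
    InD (fun j => Fin.tail (x j)) ↔ (vand e x).det ≠ 0 := by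
  rw [inD_iff, ← isUnit_iff_ne_zero, ← Matrix.isUnit_iff_isUnit_det,
    ← Matrix.linearIndependent_rows_iff_isUnit]
  exact (linearIndependent_equiv e (f := fun (j : Fin r) (β : B0 n r) =>
    monVal (Fin.tail (x j)) β.1)).symm

theorem zeros_iff_vand_mul (e : B0 n r ≃ Fin r) (x : Fin r → Fin (n + 1) → ℂ) (G : GMatrix n r) :
    (∀ j, Fin.tail (x j) ∈ zeros G) ↔ vand e x * G = wand e x := by
  simp only [mem_zeros_iff]
  constructor
  · intro h
    ext μ α
    exact h (e μ) α
  · intro h j α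
    have := congrFun (congrFun h (e.symm j)) α
    simpa [Matrix.mul_apply, vand, wand] using this

/-- There are points in `D`. -/
theorem exists_inD (hcard : Fintype.card (B0 n r) = r) : ∃ v : Fin r → Fin n → ℂ, InD v := by
  classical
  let f : (Fin n → ℂ) → B0 n r → ℂ := fun v β => monVal v β
  have hspan : Submodule.span ℂ (Set.range f) = ⊤ := by
    by_contra hne
    obtain ⟨L, hL0, hL⟩ := Submodule.exists_le_ker_of_lt_top _ (lt_top_iff_ne_top.2 hne)
    apply hL0
    -- A functional that kills all value vectors is a polynomial supported on `𝔹₀` that vanishes at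
    -- every point of `ℂ^n`.
    let p : MvPolynomial (Fin n) ℂ := ∑ β : B0 n r, monomial β.1 (L (Pi.single β 1))
    have hLf : ∀ g : B0 n r → ℂ, L g = ∑ β, g β * L (Pi.single β 1) := by
      intro g
      conv_lhs => rw [← Finset.univ_sum_single g]
      rw [map_sum]
      refine Finset.sum_congr rfl fun β _ => ?_
      rw [← smul_eq_mul, ← map_smul]
      congr 1
      ext β'
      simp [Pi.single_apply]
    have hp : p = 0 := by
      refine MvPolynomial.funext fun v => ?_
      have : L (f v) = 0 := hL (Submodule.subset_span ⟨v, rfl⟩)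
      rw [hLf] at this
      rw [map_zero, ← this, map_sum]
      refine Finset.sum_congr rfl fun β _ => ?_
      rw [← mul_one (L _), ← C_mul_monomial, map_mul, eval_C, eval_monomial_one, mul_one, mul_comm]
    have hco : ∀ β : B0 n r, L (Pi.single β 1) = 0 := by
      intro β
      have := congrArg (coeff β.1) hp
      simp only [p, coeff_sum, coeff_monomial, coeff_zero] at this
      rw [Finset.sum_eq_single β] at this
      · simpa using this
      · intro β' _ hβ'
        rw [if_neg fun h => hβ' (Subtype.ext h)]
      · simp
    ext g
    rw [LinearMap.comp_apply, hLf]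
    simp [hco]
  obtain ⟨b, hb1, hb2, hb3⟩ := exists_linearIndependent ℂ (Set.range f)
  have hbas : Module.Basis b ℂ (B0 n r → ℂ) :=
    Module.Basis.mk hb3 (by rw [Subtype.range_coe, hb2, hspan])
  have hfin : Finite b := Module.Finite.finite_basis hbas
  have hfb : Nat.card b = r := by
    rw [← Module.finrank_eq_nat_card_basis hbas]
    simp [hcard]
  let e : Fin r ≃ b := (Finite.equivFinOfCardEq hfb).symm
  choose v hv using fun j => hb1 (e j).2
  refine ⟨v, (inD_iff v).2 ?_⟩
  have : (fun (j : Fin r) (β : B0 n r) => monVal (v j) β.1) = fun j => ((e j : b) : B0 n r → ℂ) := by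
    ext j β
    exact congrFun (hv j) β
  rw [this]
  exact hb3.comp e e.injective

/-! ### The coordinate ring of the cone over the secant variety -/

theorem mem_vanishingIdeal_secantCone (p : MvPolynomial (Fin m → Fin (n + 1)) ℂ) :
    p ∈ vanishingIdeal ℂ (secantCone n m r) ↔
      ∀ u : Fin r → Fin (n + 1) → ℂ, eval (powSum m u) p = 0 := by
  constructor
  · intro h u
    have hmem : powSum m u ∈ secantCone n m r :=
      zeroLocus_vanishingIdeal_le _ ⟨u, rfl⟩
    simpa [aeval_eq_eval] using h _ hmem
  · intro h
    apply le_vanishingIdeal_zeroLocus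
    rintro _ ⟨u, rfl⟩
    simpa [aeval_eq_eval] using h u

theorem tensorPow_smul (c : ℂ) (u : Fin (n + 1) → ℂ) :
    tensorPow m (c • u) = c ^ m • tensorPow m u := by
  ext i
  simp [tensorPow, Finset.prod_mul_distrib]

theorem powSum_mem_secantCone (u : Fin r → Fin (n + 1) → ℂ) :
    powSum m u ∈ secantCone n m r :=
  zeroLocus_vanishingIdeal_le _ ⟨u, rfl⟩

theorem exists_powSum_eq_wsum (hm : 0 < m) (x : Fin r → Fin (n + 1) → ℂ) :
    ∃ u : Fin r → Fin (n + 1) → ℂ, powSum m u = wsum m x := by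
  choose ρ hρ using fun j => IsAlgClosed.exists_pow_nat_eq (x j 0) hm
  refine ⟨fun j => ρ j • homog (Fin.tail (x j)), ?_⟩
  rw [wsum_eq, powSum]
  simp only [tensorPow_smul, hρ]

theorem smul_homog_dehomog {u : Fin (n + 1) → ℂ} (hu : u 0 ≠ 0) : u 0 • homog (dehomog u) = u := by
  ext c
  refine Fin.cases ?_ (fun i => ?_) c
  · simp [homog]
  · simp [homog, dehomog, mul_div_cancel₀ _ hu]

theorem powSum_eq_wsum {u : Fin r → Fin (n + 1) → ℂ} (hu : ∀ j, u j 0 ≠ 0) :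
    powSum m u = wsum m fun j => (Fin.cons (u j 0 ^ m) (dehomog (u j)) : Fin (n + 1) → ℂ) := by
  rw [← sum_smul_tensorPow, powSum]
  refine Finset.sum_congr rfl fun j _ => ?_
  rw [← tensorPow_smul, smul_homog_dehomog (hu j)]

/-- The coordinate functions of a tuple of vectors. -/
noncomputable def genPoint (n r : ℕ) : Fin r → Fin (n + 1) → MvPolynomial (Fin r × Fin (n + 1)) ℂ :=
  fun j c => X (j, c)

/-- The sum of `m`-th powers of the generic vectors. -/
noncomputable def genPowSum (n m r : ℕ) :
    (Fin m → Fin (n + 1)) → MvPolynomial (Fin r × Fin (n + 1)) ℂ :=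
  fun i => ∑ j, ∏ k, X (j, i k)

theorem eval_aeval_genPowSum (u : Fin r → Fin (n + 1) → ℂ)
    (p : MvPolynomial (Fin m → Fin (n + 1)) ℂ) :
    eval (fun s => u s.1 s.2) (aeval (genPowSum n m r) p) = eval (powSum m u) p := by
  rw [← aeval_eq_eval, ← AlgHom.comp_apply, comp_aeval, ← aeval_eq_eval]
  congr 2
  ext i
  simp [genPowSum, powSum, tensorPow, map_sum, map_prod]

theorem eval_aeval_wsum (x : Fin r → Fin (n + 1) → ℂ)
    (p : MvPolynomial (Fin m → Fin (n + 1)) ℂ) :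
    eval (fun s => x s.1 s.2) (aeval (wsum m (genPoint n r)) p) = eval (wsum m x) p := by
  rw [← aeval_eq_eval, ← AlgHom.comp_apply, comp_aeval, ← aeval_eq_eval]
  congr 2
  ext i
  rw [map_wsum]
  simp [genPoint]

theorem mem_vanishingIdeal_iff_genPowSum (p : MvPolynomial (Fin m → Fin (n + 1)) ℂ) :
    p ∈ vanishingIdeal ℂ (secantCone n m r) ↔ aeval (genPowSum n m r) p = 0 := by
  rw [mem_vanishingIdeal_secantCone]
  constructor
  · intro h
    refine MvPolynomial.funext fun x => ?_
    rw [map_zero]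
    exact (eval_aeval_genPowSum (fun j c => x (j, c)) p).trans (h _)
  · intro h u
    rw [← eval_aeval_genPowSum, h, map_zero]

/-- Weighted sums are power sums because the `λ_j` have `m`-th roots. Conversely, power sums with
all `(u_j)_0 ≠ 0` are weighted sums, and a factor `∏ (u_j)_0` disposes of the others. So the cone
may be parametrized by `(λ, v)`. -/
theorem mem_vanishingIdeal_iff_wsum (hm : 0 < m) (p : MvPolynomial (Fin m → Fin (n + 1)) ℂ) :
    p ∈ vanishingIdeal ℂ (secantCone n m r) ↔ aeval (wsum m (genPoint n r)) p = 0 := by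
  constructor
  · intro h
    rw [mem_vanishingIdeal_secantCone] at h
    refine MvPolynomial.funext fun x => ?_
    obtain ⟨u, hu⟩ := exists_powSum_eq_wsum hm fun j c => x (j, c)
    rw [map_zero]
    refine (eval_aeval_wsum (fun j c => x (j, c)) p).trans ?_
    rw [← hu]
    exact h u
  · intro h
    rw [mem_vanishingIdeal_iff_genPowSum]
    have hprod : aeval (genPowSum n m r) p * ∏ j : Fin r, X (j, (0 : Fin (n + 1))) = 0 := by
      refine MvPolynomial.funext fun x => ?_
      rw [map_mul, map_zero, map_prod]
      by_cases hx : ∀ j : Fin r, x (j, 0) ≠ 0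
      · have h1 := eval_aeval_genPowSum (fun j c => x (j, c)) p
        rw [powSum_eq_wsum hx, ← eval_aeval_wsum, h, map_zero] at h1
        exact mul_eq_zero_of_left h1 _
      · push Not at hx
        obtain ⟨j, hj⟩ := hx
        rw [Finset.prod_eq_zero (Finset.mem_univ j) (by simpa using hj), mul_zero]
    refine (mul_eq_zero.1 hprod).resolve_right ?_
    exact Finset.prod_ne_zero_iff.2 fun j _ => X_ne_zero _

/-- The coordinate ring of the cone over `σ_r`. -/
abbrev CoordRing (n m r : ℕ) : Type :=
  MvPolynomial (Fin m → Fin (n + 1)) ℂ ⧸ vanishingIdeal ℂ (secantCone n m r)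

/-- The cone is parametrized by an affine space, so its ideal is the kernel of a homomorphism to a
polynomial ring. -/
instance (n m r : ℕ) : (vanishingIdeal ℂ (secantCone n m r)).IsPrime := by
  have : vanishingIdeal ℂ (secantCone n m r) =
      RingHom.ker (aeval (genPowSum n m r) : _ →ₐ[ℂ] MvPolynomial (Fin r × Fin (n + 1)) ℂ) := by
    ext p
    rw [mem_vanishingIdeal_iff_genPowSum, RingHom.mem_ker]
  rw [this]
  exact RingHom.ker_isPrime _

instance (n m r : ℕ) : Infinite (CoordRing n m r) :=
  Infinite.of_injective _ (FaithfulSMul.algebraMap_injective ℂ (CoordRing n m r))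

/-- The value at a point of the cone. -/
noncomputable def evalCoord (F : Tensor n m) (hF : F ∈ secantCone n m r) :
    CoordRing n m r →ₐ[ℂ] ℂ :=
  Ideal.Quotient.liftₐ _ (aeval F) fun _ hp => hp F hF

theorem evalCoord_mk (F : Tensor n m) (hF : F ∈ secantCone n m r)
    (p : MvPolynomial (Fin m → Fin (n + 1)) ℂ) :
    evalCoord F hF (Ideal.Quotient.mk _ p) = eval F p := by
  change aeval F p = _
  rw [aeval_eq_eval]

/-- Transcendence degrees add in towers. Cancellation of cardinals is legitimate since that of the
coordinate ring is at most `r(n+1)`, hence finite. -/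
theorem trdeg_eq_of_isDimensionGap {d : ℕ} (hd : IsDimensionGap n m r d) {S : Type} [CommRing S]
    [IsDomain S] [Algebra ℂ S] [Algebra (CoordRing n m r) S] [IsScalarTower ℂ (CoordRing n m r) S]
    [FaithfulSMul (CoordRing n m r) S] (hS : Algebra.trdeg ℂ S = ((r * (n + 1) : ℕ) : Cardinal)) :
    Algebra.trdeg (CoordRing n m r) S = d := by
  have h1 := trdeg_add_eq ℂ (CoordRing n m r) (A := S)
  have h2 : (d : Cardinal) + Algebra.trdeg ℂ (CoordRing n m r) = ((r * (n + 1) : ℕ) : Cardinal) := hd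
  rw [hS, ← h2, add_comm] at h1
  refine Cardinal.eq_of_add_eq_add_right h1 ?_
  refine lt_of_le_of_lt ?_ (Cardinal.natCast_lt_aleph0 (n := r * (n + 1)))
  rw [← h2]
  exact self_le_add_left _ _

end Generic

/-! ### The generic generating matrix -/

section GenericMatrix

variable {n m r : ℕ}

open Classical in
/-- The determinant of the values of `𝔹₀` at the generic points. -/
noncomputable def genDet (e : B0 n r ≃ Fin r) : MvPolynomial (Fin r × Fin (n + 1)) ℂ :=
  (vand e (genPoint n r)).det

open Classical in
theorem eval_genDet (e : B0 n r ≃ Fin r) (x : Fin r → Fin (n + 1) → ℂ) :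
    eval (fun s => x s.1 s.2) (genDet e) = (vand e x).det := by
  rw [genDet, RingHom.map_det, RingHom.mapMatrix_apply, vand_map]
  simp [genPoint]

theorem genDet_ne_zero (e : B0 n r ≃ Fin r) : genDet e ≠ 0 := by
  classical
  intro h
  obtain ⟨v, hv⟩ := exists_inD (n := n) (r := r) ((Fintype.card_congr e).trans (Fintype.card_fin r))
  have h1 := eval_genDet e fun j => (Fin.cons 0 (v j) : Fin (n + 1) → ℂ)
  rw [h, map_zero] at h1
  refine (inD_iff_det e fun j => (Fin.cons 0 (v j) : Fin (n + 1) → ℂ)).1 ?_ h1.symm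
  simpa using hv

/-- The coordinate ring of the set of the `(λ_j, v_j)` with `(v₁, …, v_r) ∈ D`. -/
abbrev LocRing (e : B0 n r ≃ Fin r) : Type := Localization.Away (genDet e)

/-- The generic point of `D`. -/
noncomputable def locPoint (e : B0 n r ≃ Fin r) : Fin r → Fin (n + 1) → LocRing e :=
  fun j c => algebraMap _ _ (genPoint n r j c)

open Classical in
/-- The generating matrix of the generic point of `D`. -/
noncomputable def genG (e : B0 n r ≃ Fin r) : Matrix (B0 n r) (B1 n r) (LocRing e) :=
  (vand e (locPoint e))⁻¹ * wand e (locPoint e)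

open Classical in
theorem algebraMap_genDet (e : B0 n r ≃ Fin r) :
    algebraMap _ (LocRing e) (genDet e) = (vand e (locPoint e)).det := by
  have h := RingHom.map_det (algebraMap _ (LocRing e)) (vand e (genPoint n r))
  rw [RingHom.mapMatrix_apply, vand_map] at h
  exact h

open Classical in
theorem isUnit_det_locPoint (e : B0 n r ≃ Fin r) : IsUnit (vand e (locPoint e)).det := by
  rw [← algebraMap_genDet]
  exact IsLocalization.Away.algebraMap_isUnit (S := LocRing e) (genDet e)

theorem vand_mul_genG (e : B0 n r ≃ Fin r) :
    vand e (locPoint e) * genG e = wand e (locPoint e) := by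
  classical
  rw [genG, ← Matrix.mul_assoc, Matrix.mul_nonsing_inv _ (isUnit_det_locPoint e), Matrix.one_mul]

instance (e : B0 n r ≃ Fin r) : IsDomain (LocRing e) :=
  IsLocalization.isDomain_localization
    (powers_le_nonZeroDivisors_of_noZeroDivisors (genDet_ne_zero e))

theorem algebraMap_locRing_injective (e : B0 n r ≃ Fin r) :
    Function.Injective (algebraMap (MvPolynomial (Fin r × Fin (n + 1)) ℂ) (LocRing e)) :=
  IsLocalization.injective _
    (powers_le_nonZeroDivisors_of_noZeroDivisors (genDet_ne_zero e))

theorem trdeg_mvPolynomial_prod (n r : ℕ) :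
    Algebra.trdeg ℂ (MvPolynomial (Fin r × Fin (n + 1)) ℂ) = ((r * (n + 1) : ℕ) : Cardinal) := by
  rw [trdeg_of_isDomain]
  simp

theorem trdeg_locRing (e : B0 n r ≃ Fin r) :
    Algebra.trdeg ℂ (LocRing e) = ((r * (n + 1) : ℕ) : Cardinal) := by
  have : FaithfulSMul (MvPolynomial (Fin r × Fin (n + 1)) ℂ) (LocRing e) :=
    (faithfulSMul_iff_algebraMap_injective _ _).2 (algebraMap_locRing_injective e)
  have : Algebra.IsAlgebraic (MvPolynomial (Fin r × Fin (n + 1)) ℂ) (LocRing e) :=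
    IsLocalization.isAlgebraic _ (Submonoid.powers (genDet e))
  rw [← trdeg_add_eq ℂ (MvPolynomial (Fin r × Fin (n + 1)) ℂ) (A := LocRing e),
    trdeg_mvPolynomial_prod, _root_.trdeg_eq_zero, add_zero]

/-- The homomorphism of coordinate rings given by `(λ, v) ↦ ∑ λ_j (1, v_j)^{⊗m}`. -/
noncomputable def coordHom (hm : 0 < m) (e : B0 n r ≃ Fin r) : CoordRing n m r →ₐ[ℂ] LocRing e :=
  Ideal.Quotient.liftₐ _ ((IsScalarTower.toAlgHom ℂ _ (LocRing e)).comp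
    (aeval (wsum m (genPoint n r)))) fun p hp => by
      rw [AlgHom.comp_apply, (mem_vanishingIdeal_iff_wsum hm p).1 hp, map_zero]

theorem coordHom_mk (hm : 0 < m) (e : B0 n r ≃ Fin r)
    (p : MvPolynomial (Fin m → Fin (n + 1)) ℂ) :
    coordHom hm e (Ideal.Quotient.mk _ p) = algebraMap _ _ (aeval (wsum m (genPoint n r)) p) :=
  rfl

theorem coordHom_mk_X (hm : 0 < m) (e : B0 n r ≃ Fin r) (i : Fin m → Fin (n + 1)) :
    coordHom hm e (Ideal.Quotient.mk _ (X i)) = wsum m (locPoint e) i := by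
  rw [coordHom_mk, aeval_X, map_wsum]
  rfl

theorem coordHom_injective (hm : 0 < m) (e : B0 n r ≃ Fin r) :
    Function.Injective (coordHom (n := n) hm e) := by
  rw [injective_iff_map_eq_zero]
  intro a ha
  obtain ⟨p, rfl⟩ := Ideal.Quotient.mk_surjective a
  rw [Ideal.Quotient.eq_zero_iff_mem, mem_vanishingIdeal_iff_wsum hm]
  rw [coordHom_mk] at ha
  exact (injective_iff_map_eq_zero _).1 (algebraMap_locRing_injective e) _ ha

/-- A point of `D` is algebraic over the entries of its tensor and of its generating matrix. -/
theorem isAlgebraic_of_generatingMatrix (hr : 0 < r) (hrN : r ≤ (n + m).choose m)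
    (e : B0 n r ≃ Fin r) {K L : Type*} [CommRing K] [IsDomain K] [CommRing L] [IsDomain L]
    [Algebra K L] [FaithfulSMul K L] (x : Fin r → Fin (n + 1) → L) (G : Matrix (B0 n r) (B1 n r) L)
    (hVG : vand e x * G = wand e x) {w : L} (hw : (vand e x).det * w = 1)
    (hF : ∀ i, wsum m x i ∈ (algebraMap K L).range)
    (hG : ∀ β α, G β α ∈ (algebraMap K L).range) :
    (∀ j c, IsAlgebraic K (x j c)) ∧ IsAlgebraic K w := by
  classical
  set Z := Subalgebra.algebraicClosure K L with hZ
  have hKZ : ∀ a ∈ (algebraMap K L).range, a ∈ Z := by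
    rintro _ ⟨a, rfl⟩
    exact isAlgebraic_algebraMap a
  have hcoord : ∀ (j : Fin r) (i : Fin n), x j i.succ ∈ Z := by
    intro j i
    let b : B0 n r → L := fun β => monVal (Fin.tail (x j)) β.1
    -- The values of `𝔹₀` at `v_j` span a finitely generated module containing `1`. It is stable
    -- under multiplication by `v_{j,i}` because `V G = W` rewrites values of `𝔹₁`; hence `v_{j,i}`
    -- is integral.
    let N : Submodule K L := Submodule.span K (Set.range b)
    have hb : ∀ β, b β ∈ N := fun β => Submodule.subset_span ⟨β, rfl⟩
    have hint : IsIntegral K (x j i.succ) := by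
      refine isIntegral_of_smul_mem_submodule N ?_ (Submodule.fg_span (Set.finite_range b)) _ ?_
      · intro h
        have h1 := hb ⟨0, zero_mem_B0 hr⟩
        rw [h, Submodule.mem_bot] at h1
        simp [b, monVal] at h1
      · intro y hy
        induction hy using Submodule.span_induction with
        | mem y hy =>
          obtain ⟨β, rfl⟩ := hy
          have h1 : x j i.succ • b β =
              monVal (Fin.tail (x j)) (β.1 + Finsupp.single i 1) := by
            rw [monVal_add_single, smul_eq_mul, mul_comm]
            rfl
          rw [h1]
          by_cases h : β.1 + Finsupp.single i 1 ∈ B0 n r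
          · exact hb ⟨_, h⟩
          · have h2 := congrFun (congrFun (hVG) (e.symm j))
              ⟨_, h, β.1, β.2, i, rfl⟩
            simp only [Matrix.mul_apply, vand, wand, Matrix.of_apply, Equiv.apply_symm_apply] at h2
            rw [← h2]
            refine Submodule.sum_mem _ fun β' _ => ?_
            obtain ⟨a, ha⟩ := hG β' ⟨_, h, β.1, β.2, i, rfl⟩
            rw [mul_comm, ← ha, ← Algebra.smul_def]
            exact N.smul_mem a (hb β')
        | zero => simp
        | add y z _ _ hy hz => rw [smul_add]; exact N.add_mem hy hz
        | smul c y _ hy => rw [smul_comm]; exact N.smul_mem _ hy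
    exact hint.isAlgebraic
  have hmon : ∀ j α, monVal (Fin.tail (x j)) α ∈ Z := fun j α =>
    Subalgebra.prod_mem _ fun i _ => Subalgebra.pow_mem _ (hcoord j i) _
  -- Lifting the matrix to `Z` shows that its determinant and the entries of its adjugate are
  -- algebraic.
  let V' : Matrix (B0 n r) (B0 n r) Z := fun μ β => ⟨vand e x μ β, hmon _ _⟩
  have hdet : Z.val V'.det = (vand e (x)).det := AlgHom.map_det Z.val V'
  have hadj : Z.val.mapMatrix V'.adjugate = (vand e (x)).adjugate :=
    AlgHom.map_adjugate Z.val V'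
  have hdetZ : (vand e (x)).det ∈ Z := by rw [← hdet]; exact V'.det.2
  have hwZ : w ∈ Z := by
    let _ : Invertible (vand e (x)).det := invertibleOfRightInverse _ _ hw
    have : IsAlgebraic K (⅟ (vand e (x)).det) := IsAlgebraic.invOf hdetZ
    rw [invOf_eq_right_inv hw] at this
    exact this
  have hlam : ∀ j, x j 0 ∈ Z := by
    intro j
    -- The row `λ V` consists of entries of the tensor. Cramer's rule recovers `λ` through the
    -- adjugate and `w = (det V)⁻¹`.
    have h1 : Matrix.vecMul (fun μ => x (e μ) 0) (vand e (x)) =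
        fun β => ∑ j, x j 0 * monVal (Fin.tail (x j)) β.1 := by
      ext β
      simp only [Matrix.vecMul, dotProduct, vand, Matrix.of_apply]
      exact e.sum_comp fun j => x j 0 * monVal (Fin.tail (x j)) β.1
    have h2 : ∀ β : B0 n r,
        ∑ j, x j 0 * monVal (Fin.tail (x j)) β.1 ∈ Z := by
      intro β
      obtain ⟨i, hi⟩ := content_surjective (degree_le_of_mem_B0 hrN β.2)
      rw [← hi]
      exact hKZ _ (hF i)
    have h3 := congrArg (fun f => Matrix.vecMul f (vand e (x)).adjugate) h1
    simp only [Matrix.vecMul_vecMul, Matrix.mul_adjugate] at h3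
    have h4 := congrFun h3 (e.symm j)
    rw [Matrix.vecMul_smul, Matrix.vecMul_one] at h4
    simp only [Pi.smul_apply, smul_eq_mul, Equiv.apply_symm_apply] at h4
    have h5 : x j 0 = w * ((vand e (x)).det * x j 0) := by
      rw [← mul_assoc, mul_comm w, hw, one_mul]
    rw [h5, h4]
    refine Subalgebra.mul_mem _ hwZ (Subalgebra.sum_mem _ fun β _ =>
      Subalgebra.mul_mem _ (h2 β) ?_)
    rw [← hadj]
    exact (V'.adjugate β (e.symm j)).2
  exact ⟨fun j c => Fin.cases (hlam j) (fun i => hcoord j i) c, hwZ⟩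

/-- The generic point is algebraic over the entries of its tensor and of its generating matrix. -/
theorem isAlgebraic_of_genG_mem (hr : 0 < r) (hrN : r ≤ (n + m).choose m) (e : B0 n r ≃ Fin r)
    {K : Type*} [CommRing K] [IsDomain K] [Algebra K (LocRing e)] [FaithfulSMul K (LocRing e)]
    [Algebra ℂ K] [IsScalarTower ℂ K (LocRing e)]
    (hF : ∀ i, wsum m (locPoint e) i ∈ (algebraMap K (LocRing e)).range)
    (hG : ∀ β α, genG e β α ∈ (algebraMap K (LocRing e)).range) :
    Algebra.IsAlgebraic K (LocRing e) := by
  classical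
  obtain ⟨w, hw⟩ := (isUnit_det_locPoint e).exists_right_inv
  obtain ⟨hpoint, hwZ⟩ :=
    isAlgebraic_of_generatingMatrix hr hrN e _ _ (vand_mul_genG e) hw hF hG
  have hpoly : ∀ p : MvPolynomial (Fin r × Fin (n + 1)) ℂ,
      IsAlgebraic K (algebraMap _ (LocRing e) p) := by
    intro p
    induction p using MvPolynomial.induction_on with
    | C a =>
      rw [← MvPolynomial.algebraMap_eq, ← IsScalarTower.algebraMap_apply,
        IsScalarTower.algebraMap_apply ℂ K (LocRing e)]
      exact isAlgebraic_algebraMap _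
    | add p q hp hq => rw [map_add]; exact hp.add hq
    | mul_X p s hp => rw [map_mul]; exact hp.mul (hpoint s.1 s.2)
  refine ⟨fun z => ?_⟩
  obtain ⟨k, p, hp⟩ := IsLocalization.Away.surj (genDet e) z
  have hz : z = algebraMap _ (LocRing e) p * w ^ k := by
    rw [← hp, algebraMap_genDet, mul_assoc, ← mul_pow, hw, one_pow, mul_one]
  rw [hz]
  exact (hpoly p).mul (hwZ.pow k)

end GenericMatrix

/-! ### Points of an extension cut out by general linear equations -/

section GeneralSlice

/-- Polynomials in the data of `d` linear equations in variables indexed by `ι`. -/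
abbrev EqRing (A ι : Type) [CommRing A] (d : ℕ) : Type := MvPolynomial ((Fin d × ι) ⊕ Fin d) A

/-- Polynomials in the coefficients of `d` linear forms in variables indexed by `ι`. -/
abbrev CoefRing (L ι : Type) [CommRing L] (d : ℕ) : Type := MvPolynomial (Fin d × ι) L

/-- Send the right sides of the equations to the generic forms. Since these are a transcendence
basis, `EqRing` embeds in `CoefRing` with algebraic extension, and points of `CoefRing` above `(φ,
a, b)` are the points of `L` above `φ` that satisfy the equations. So `exists_general_fiber`
applies. -/
theorem exists_general_slice {A L ι : Type} [CommRing A] [IsDomain A] [Infinite A] [CommRing L]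
    [IsDomain L] [Algebra ℂ A] [Algebra ℂ L] [Algebra A L] [IsScalarTower ℂ A L]
    [FaithfulSMul A L] [Algebra.FiniteType ℂ L] [Fintype ι] {d : ℕ} {g : ι → L} {E : Fin d → ι}
    (hE : IsTranscendenceBasis A fun k => g (E k)) {z : L} (hz : z ≠ 0) :
    ∃ f : MvPolynomial ((Fin d × ι) ⊕ Fin d) A, f ≠ 0 ∧
      ∀ (φ : A →ₐ[ℂ] ℂ) (a : Fin d × ι → ℂ) (b : Fin d → ℂ),
        eval (Sum.elim a b) (map (φ : A →+* ℂ) f) ≠ 0 →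
        {ψ : L →ₐ[ℂ] ℂ | (∀ x, ψ (algebraMap A L x) = φ x) ∧
          ∀ k, ∑ p, a (k, p) * ψ (g p) = b k}.Nonempty ∧
        {ψ : L →ₐ[ℂ] ℂ | (∀ x, ψ (algebraMap A L x) = φ x) ∧
          ∀ k, ∑ p, a (k, p) * ψ (g p) = b k}.Finite ∧
        ∀ ψ : L →ₐ[ℂ] ℂ, (∀ x, ψ (algebraMap A L x) = φ x) →
          (∀ k, ∑ p, a (k, p) * ψ (g p) = b k) → ψ z ≠ 0 := by
  classical
  have hT := isTranscendenceBasis_genericForms hE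
  let ev : EqRing A ι d →ₐ[A] CoefRing L ι d := aeval (genericForms d g)
  let _ : Algebra (EqRing A ι d) (CoefRing L ι d) := ev.toRingHom.toAlgebra
  have hmap : ∀ x : EqRing A ι d, algebraMap (EqRing A ι d) (CoefRing L ι d) x = ev x :=
    fun _ => rfl
  have : IsScalarTower A (EqRing A ι d) (CoefRing L ι d) :=
    IsScalarTower.of_algebraMap_eq fun x => (ev.commutes x).symm
  have : IsScalarTower ℂ (EqRing A ι d) (CoefRing L ι d) := by
    refine IsScalarTower.of_algebraMap_eq fun x => ?_
    rw [IsScalarTower.algebraMap_apply ℂ A (CoefRing L ι d),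
      IsScalarTower.algebraMap_apply ℂ A (EqRing A ι d), hmap, ev.commutes]
  have hinj : Function.Injective (algebraMap (EqRing A ι d) (CoefRing L ι d)) := hT.1
  have : Algebra.IsAlgebraic (EqRing A ι d) (CoefRing L ι d) := by
    have := hT.isAlgebraic
    refine Algebra.IsAlgebraic.of_ringHom_of_comp_eq hT.1.aevalEquiv (RingHom.id (CoefRing L ι d))
      hT.1.aevalEquiv.surjective Function.injective_id ?_
    refine RingHom.ext fun x => ?_
    exact hT.1.algebraMap_aevalEquiv x
  have : Algebra.FiniteType ℂ (CoefRing L ι d) := inferInstanceAs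
    (Algebra.FiniteType ℂ (MvPolynomial (Fin d × ι) L))
  obtain ⟨f, hf, hfib⟩ := exists_general_fiber (R := EqRing A ι d) (S := CoefRing L ι d) hinj
    (z := C z) (by rwa [Ne, C_eq_zero])
  refine ⟨f, hf, fun φ a b hab => ?_⟩
  let Φ : EqRing A ι d →ₐ[ℂ] ℂ := (aeval (Sum.elim a b)).comp (mapAlgHom φ)
  have hΦ : ∀ x : EqRing A ι d, Φ x = eval (Sum.elim a b) (map (φ : A →+* ℂ) x) := fun x => by
    simp [Φ, aeval_eq_eval]
  -- `up ψ` extends `ψ` by giving the indeterminate coefficients the values `a`.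
  let up : (L →ₐ[ℂ] ℂ) → (CoefRing L ι d →ₐ[ℂ] ℂ) := fun ψ => (aeval a).comp (mapAlgHom ψ)
  have hupC : ∀ ψ y, up ψ (C y) = ψ y := fun ψ y => by simp [up]
  have hupX : ∀ ψ s, up ψ (X s) = a s := fun ψ s => by simp [up]
  have hup : ∀ ψ : L →ₐ[ℂ] ℂ, (∀ x, ψ (algebraMap A L x) = φ x) →
      (∀ k, ∑ p, a (k, p) * ψ (g p) = b k) →
      ∀ x, up ψ (algebraMap (EqRing A ι d) (CoefRing L ι d) x) = Φ x := by
    intro ψ h1 h2 x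
    have : (up ψ : CoefRing L ι d →+* ℂ).comp (algebraMap (EqRing A ι d) (CoefRing L ι d)) =
        (Φ : EqRing A ι d →+* ℂ) := by
      apply MvPolynomial.ringHom_ext
      · intro y
        have h3 : algebraMap (EqRing A ι d) (CoefRing L ι d) (C y) = C (algebraMap A L y) :=
          (IsScalarTower.algebraMap_apply A (EqRing A ι d) (CoefRing L ι d) y).symm
        simp only [RingHom.comp_apply, h3]
        change up ψ (C _) = Φ (C y)
        rw [hupC, h1, hΦ]
        simp
      · intro s
        change up ψ (ev (X s)) = Φ (X s)
        rw [hΦ]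
        rcases s with s | k
        · simp [ev, genericForms, hupX]
        · simp [ev, genericForms, hupX, hupC, h2]
    exact RingHom.congr_fun this x
  obtain ⟨⟨Ψ, hΨ⟩, hfin, hne⟩ := hfib Φ (by rwa [hΦ])
  refine ⟨?_, ?_, fun ψ h1 h2 => ?_⟩
  · refine ⟨Ψ.comp (IsScalarTower.toAlgHom ℂ L (CoefRing L ι d)), fun x => ?_, fun k => ?_⟩
    · have h3 : algebraMap (EqRing A ι d) (CoefRing L ι d) (C x) = C (algebraMap A L x) :=
          (IsScalarTower.algebraMap_apply A (EqRing A ι d) (CoefRing L ι d) x).symm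
      have := hΨ (C x)
      rw [h3, hΦ] at this
      simpa using this
    · have h4 : ∀ s, Ψ (X s) = a s := by
        intro s
        have := hΨ (X (Sum.inl s))
        rw [hmap, hΦ] at this
        simpa [ev, genericForms] using this
      have := hΨ (X (Sum.inr k))
      rw [hmap, hΦ] at this
      simpa [ev, genericForms, h4] using this
  · refine Set.Finite.of_finite_image (f := up) (hfin.subset ?_) ?_
    · rintro _ ⟨ψ, ⟨h1, h2⟩, rfl⟩
      exact hup ψ h1 h2
    · intro ψ _ ψ' _ h
      ext y
      rw [← hupC, ← hupC, h]
  · rw [← hupC]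
    exact hne (up ψ) (hup ψ h1 h2)

end GeneralSlice

/-! ### Finite slices of the decompositions of a general tensor -/

section General

variable {n m r d : ℕ}

/-- `LocRing e` is algebraic over the subalgebra generated by the entries of the generic `G`, so a
transcendence basis can be selected among them. The dimension gap forces it to have `d` members. -/
theorem exists_isTranscendenceBasis_genG (hm : 0 < m) (hr : 0 < r) (hrN : r ≤ (n + m).choose m)
    (hd : IsDimensionGap n m r d) (e : B0 n r ≃ Fin r) [Algebra (CoordRing n m r) (LocRing e)]
    [IsScalarTower ℂ (CoordRing n m r) (LocRing e)]
    (hmap : ∀ x, algebraMap (CoordRing n m r) (LocRing e) x = coordHom hm e x) :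
    ∃ E : Fin d → B0 n r × B1 n r,
      IsTranscendenceBasis (CoordRing n m r) fun k => genG e (E k).1 (E k).2 := by
  have hinj : Function.Injective (algebraMap (CoordRing n m r) (LocRing e)) := by
    intro x y h
    rw [hmap, hmap] at h
    exact coordHom_injective hm e h
  have : FaithfulSMul (CoordRing n m r) (LocRing e) :=
    (faithfulSMul_iff_algebraMap_injective _ _).2 hinj
  let s : Set (LocRing e) := Set.range fun p : B0 n r × B1 n r => genG e p.1 p.2
  have halg : Algebra.IsAlgebraic (Algebra.adjoin (CoordRing n m r) s) (LocRing e) := by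
    refine isAlgebraic_of_genG_mem hr hrN e (fun i => ?_) fun β α => ?_
    · refine ⟨⟨wsum m (locPoint e) i, ?_⟩, rfl⟩
      rw [← coordHom_mk_X hm, ← hmap]
      exact Subalgebra.algebraMap_mem _ _
    · exact ⟨⟨_, Algebra.subset_adjoin ⟨(β, α), rfl⟩⟩, rfl⟩
  obtain ⟨t, hts, ht⟩ := exists_isTranscendenceBasis_subset (R := CoordRing n m r) s
  have hcard : Cardinal.mk t = Cardinal.mk (Fin d) := by
    rw [ht.cardinalMk_eq_trdeg, trdeg_eq_of_isDimensionGap hd (trdeg_locRing e), Cardinal.mk_fin]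
  obtain ⟨ε⟩ := Cardinal.eq.1 hcard
  choose E hE using fun k => hts (ε.symm k).2
  refine ⟨E, ?_⟩
  have h1 : (fun k => genG e (E k).1 (E k).2) = Subtype.val ∘ ε.symm := funext hE
  rw [h1]
  exact ht.comp_equiv ε.symm

/-- The decompositions in `D` of `F` whose generating matrix satisfies linear equations. -/
def sliceSet (F : Tensor n m) (a : Fin d × (B0 n r × B1 n r) → ℂ) (b : Fin d → ℂ) :
    Set (Fin r → Fin (n + 1) → ℂ) :=
  {x | wsum m x = F ∧ InD (fun j => Fin.tail (x j)) ∧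
    ∃ G : GMatrix n r, (∀ j, Fin.tail (x j) ∈ zeros G) ∧
      ∀ k, ∑ p, a (k, p) * G p.1 p.2 = b k}

/-- General linear equations for the generating matrix cut out a finite nonempty set of
decompositions, all of whose coefficients are nonzero. -/
def HasGeneralSlices (r d : ℕ) (F : Tensor n m) : Prop :=
  ∃ Q : MvPolynomial ((Fin d × (B0 n r × B1 n r)) ⊕ Fin d) ℂ, Q ≠ 0 ∧
    ∀ a b, eval (Sum.elim a b) Q ≠ 0 →
      (sliceSet F a b).Nonempty ∧ (sliceSet F a b).Finite ∧
        ∀ x ∈ sliceSet F a b, ∀ j, x j 0 ≠ 0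

/-- The points of `LocRing e` are the `(λ, v)` with `v` in `D`, and those above the point `F` are
the decompositions of `F` there. So this is `exists_general_slice` for the entries of the generic
`G`, with `∏ λ_j` as the element that must not vanish. -/
theorem exists_hasGeneralSlices (hm : 0 < m) (hr : 0 < r) (hrN : r ≤ (n + m).choose m)
    (hd : IsDimensionGap n m r d) :
    ∃ p : MvPolynomial (Fin m → Fin (n + 1)) ℂ, p ∉ vanishingIdeal ℂ (secantCone n m r) ∧
      ∀ F ∈ secantCone n m r, eval F p ≠ 0 → HasGeneralSlices r d F := by
  classical
  let e : B0 n r ≃ Fin r := Fintype.equivFinOfCardEq (card_B0 hrN)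
  let _ : Algebra (CoordRing n m r) (LocRing e) := (coordHom hm e).toRingHom.toAlgebra
  have hmap : ∀ x, algebraMap (CoordRing n m r) (LocRing e) x = coordHom hm e x := fun _ => rfl
  have : IsScalarTower ℂ (CoordRing n m r) (LocRing e) :=
    IsScalarTower.of_algebraMap_eq fun x => ((coordHom hm e).commutes x).symm
  obtain ⟨E, hE⟩ := exists_isTranscendenceBasis_genG hm hr hrN hd e hmap
  have : FaithfulSMul (CoordRing n m r) (LocRing e) :=
    (faithfulSMul_iff_algebraMap_injective _ _).2 (coordHom_injective hm e)
  have hz : ∏ j, locPoint e j 0 ≠ 0 := by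
    refine Finset.prod_ne_zero_iff.2 fun j _ => ?_
    exact (map_ne_zero_iff _ (algebraMap_locRing_injective e)).2 (X_ne_zero _)
  obtain ⟨f, hf, hfib⟩ := exists_general_slice
    (g := fun p : B0 n r × B1 n r => genG e p.1 p.2) hE hz
  -- The open set in `F` is where one nonzero coefficient of `f` survives; there `f` specializes to
  -- a nonzero polynomial in `(a, b)`.
  obtain ⟨μ, hμ⟩ := ne_zero_iff.1 hf
  obtain ⟨p, hp⟩ := Ideal.Quotient.mk_surjective (coeff μ f)
  refine ⟨p, ?_, fun F hF hFp => ?_⟩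
  · rw [← Ideal.Quotient.eq_zero_iff_mem, hp]
    exact hμ
  refine ⟨map (evalCoord F hF : CoordRing n m r →+* ℂ) f, ?_, fun a b hab => ?_⟩
  · rw [ne_zero_iff]
    refine ⟨μ, ?_⟩
    rw [coeff_map, ← hp]
    exact fun h => hFp ((evalCoord_mk F hF p).symm.trans h)
  obtain ⟨hne, hfin, hnz⟩ := hfib (evalCoord F hF) a b hab
  -- the point given by a homomorphism
  let pt : (LocRing e →ₐ[ℂ] ℂ) → Fin r → Fin (n + 1) → ℂ := fun ψ j c => ψ (locPoint e j c)
  have hpt_wsum : ∀ ψ : LocRing e →ₐ[ℂ] ℂ,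
      (∀ x, ψ (algebraMap (CoordRing n m r) (LocRing e) x) = evalCoord F hF x) →
      wsum m (pt ψ) = F := by
    intro ψ hψ
    ext i
    have h1 := hψ (Ideal.Quotient.mk _ (X i))
    rw [evalCoord_mk, hmap, coordHom_mk_X, map_wsum, eval_X] at h1
    exact h1
  have hpt_det : ∀ ψ : LocRing e →ₐ[ℂ] ℂ, InD fun j => Fin.tail (pt ψ j) := by
    intro ψ
    rw [inD_iff_det e]
    have h1 := (isUnit_det_locPoint e).map (ψ : LocRing e →+* ℂ)
    rw [RingHom.map_det, RingHom.mapMatrix_apply, vand_map] at h1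
    exact h1.ne_zero
  have hpt_zeros : ∀ ψ : LocRing e →ₐ[ℂ] ℂ, ∀ j,
      Fin.tail (pt ψ j) ∈ zeros ((genG e).map (ψ : LocRing e →+* ℂ)) := by
    intro ψ
    rw [zeros_iff_vand_mul e]
    have h1 := congrArg (fun M => M.map (ψ : LocRing e →+* ℂ)) (vand_mul_genG e)
    simp only [Matrix.map_mul, vand_map, wand_map] at h1
    exact h1
  have hsub : sliceSet F a b ⊆ pt '' {ψ : LocRing e →ₐ[ℂ] ℂ |
      (∀ x, ψ (algebraMap (CoordRing n m r) (LocRing e) x) = evalCoord F hF x) ∧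
        ∀ k, ∑ p : B0 n r × B1 n r, a (k, p) * ψ (genG e p.1 p.2) = b k} := by
    rintro x ⟨hx, hxD, G, hG, hGab⟩
    -- Membership in `D` is what extends evaluation at `x` to the localization.
    have hunit : IsUnit ((aeval (fun s : Fin r × Fin (n + 1) => x s.1 s.2) : _ →ₐ[ℂ] ℂ) (genDet e)) := by
      rw [aeval_eq_eval, isUnit_iff_ne_zero]
      have := (inD_iff_det e x).1 hxD
      rw [← eval_genDet] at this
      exact this
    let ψ : LocRing e →ₐ[ℂ] ℂ := IsLocalization.Away.liftAlgHom (genDet e) hunit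
    have hψ : ∀ q, ψ (algebraMap _ _ q) = eval (fun s : Fin r × Fin (n + 1) => x s.1 s.2) q := by
      intro q
      have : ψ (algebraMap _ _ q) = (aeval (fun s : Fin r × Fin (n + 1) => x s.1 s.2) : _ →ₐ[ℂ] ℂ) q :=
        IsLocalization.Away.lift_eq (genDet e) hunit q
      rw [this, aeval_eq_eval]
    have hptψ : pt ψ = x := by
      ext j c
      change ψ (algebraMap _ _ _) = _
      rw [hψ]
      simp [genPoint]
    refine ⟨ψ, ⟨fun y => ?_, fun k => ?_⟩, hptψ⟩
    · obtain ⟨q, rfl⟩ := Ideal.Quotient.mk_surjective y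
      rw [evalCoord_mk, hmap, coordHom_mk, hψ, eval_aeval_wsum, hx]
    · have h1 := hpt_zeros ψ
      have h2 := hpt_det ψ
      rw [hptψ] at h1 h2
      have h3 := generatingMatrix_unique (card_B0 hrN) h2 h1 hG
      rw [← hGab k, ← h3]
      rfl
  refine ⟨?_, (hfin.image pt).subset hsub, fun x hx j => ?_⟩
  · obtain ⟨ψ, h1, h2⟩ := hne
    exact ⟨pt ψ, hpt_wsum ψ h1, hpt_det ψ, _, hpt_zeros ψ, h2⟩
  · obtain ⟨ψ, ⟨h1, h2⟩, rfl⟩ := hsub hx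
    have h3 := hnz ψ h1 h2
    rw [map_prod] at h3
    exact Finset.prod_ne_zero_iff.1 h3 j (Finset.mem_univ j)

end General

/-! ### Membership in `D` of all decompositions when `d = 0` -/

section Goodness

variable {n m r : ℕ}

/-- The homomorphism of coordinate rings given by `u ↦ ∑ u_j^{⊗m}`. -/
noncomputable def powHom (n m r : ℕ) : CoordRing n m r →ₐ[ℂ] MvPolynomial (Fin r × Fin (n + 1)) ℂ :=
  Ideal.Quotient.liftₐ _ (aeval (genPowSum n m r)) fun p hp =>
    (mem_vanishingIdeal_iff_genPowSum p).1 hp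

theorem powHom_mk (p : MvPolynomial (Fin m → Fin (n + 1)) ℂ) :
    powHom n m r (Ideal.Quotient.mk _ p) = aeval (genPowSum n m r) p :=
  rfl

theorem powHom_injective : Function.Injective (powHom n m r) := by
  rw [injective_iff_map_eq_zero]
  intro a ha
  obtain ⟨p, rfl⟩ := Ideal.Quotient.mk_surjective a
  rw [Ideal.Quotient.eq_zero_iff_mem, mem_vanishingIdeal_iff_genPowSum]
  exact ha

/-- The values of the homogenizations of the monomials of `𝔹₀`. -/
noncomputable def homogVand {S : Type*} [CommSemiring S] (m : ℕ) (e : B0 n r ≃ Fin r)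
    (u : Fin r → Fin (n + 1) → S) : Matrix (B0 n r) (B0 n r) S :=
  Matrix.of fun μ β => u (e μ) 0 ^ (m - β.1.degree) * monVal (Fin.tail (u (e μ))) β

theorem homogVand_map {S T : Type*} [CommSemiring S] [CommSemiring T] (ψ : S →+* T)
    (e : B0 n r ≃ Fin r) (u : Fin r → Fin (n + 1) → S) :
    (homogVand m e u).map ψ = homogVand m e fun j c => ψ (u j c) := by
  ext μ β
  simp only [Matrix.map_apply, homogVand, Matrix.of_apply, map_monVal, map_mul, map_pow]
  rfl

theorem monVal_tail {u : Fin (n + 1) → ℂ} (hu : u 0 ≠ 0) {β : Fin n →₀ ℕ} (h : β.degree ≤ m) :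
    u 0 ^ (m - β.degree) * monVal (Fin.tail u) β = u 0 ^ m * monVal (dehomog u) β := by
  have h1 : monVal (Fin.tail u) β = u 0 ^ β.degree * monVal (dehomog u) β := by
    rw [Finsupp.degree_eq_sum, ← Finset.prod_pow_eq_pow_sum, monVal, monVal,
      ← Finset.prod_mul_distrib]
    refine Finset.prod_congr rfl fun i _ => ?_
    rw [← mul_pow, dehomog, mul_div_cancel₀ _ hu]
    rfl
  rw [h1, ← mul_assoc, ← pow_add, Nat.sub_add_cancel h]

-- Each row of the homogenized matrix is `(u_j)_0 ^ m` times the row of values at the dehomogenized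
-- point.
open Classical in
theorem inD_dehomog (hrN : r ≤ (n + m).choose m) (e : B0 n r ≃ Fin r)
    {u : Fin r → Fin (n + 1) → ℂ} (hu : ∀ j, u j 0 ≠ 0) (h : (homogVand m e u).det ≠ 0) :
    InD fun j => dehomog (u j) := by
  have h1 : homogVand m e u = Matrix.diagonal (fun μ => u (e μ) 0 ^ m) *
      vand e fun j => (Fin.cons 1 (dehomog (u j)) : Fin (n + 1) → ℂ) := by
    ext μ β
    rw [Matrix.diagonal_mul]
    simpa [homogVand, vand] using monVal_tail (hu (e μ)) (degree_le_of_mem_B0 hrN β.2)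
  rw [h1, Matrix.det_mul] at h
  have h2 := (inD_iff_det e fun j => (Fin.cons 1 (dehomog (u j)) : Fin (n + 1) → ℂ)).2
    (right_ne_zero_of_mul h)
  simpa using h2

/-- If `d = 0`, all decompositions of a general tensor are in `D`. -/
theorem exists_general_inD (hrN : r ≤ (n + m).choose m) (hd : IsDimensionGap n m r 0) :
    ∃ p : MvPolynomial (Fin m → Fin (n + 1)) ℂ, p ∉ vanishingIdeal ℂ (secantCone n m r) ∧
      ∀ u : Fin r → Fin (n + 1) → ℂ, eval (powSum m u) p ≠ 0 →
        (∀ j, u j 0 ≠ 0) ∧ InD fun j => dehomog (u j) := by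
  classical
  let e : B0 n r ≃ Fin r := Fintype.equivFinOfCardEq (card_B0 hrN)
  let _ : Algebra (CoordRing n m r) (MvPolynomial (Fin r × Fin (n + 1)) ℂ) :=
    (powHom n m r).toRingHom.toAlgebra
  have hmap : ∀ x, algebraMap (CoordRing n m r) (MvPolynomial (Fin r × Fin (n + 1)) ℂ) x =
    powHom n m r x := fun _ => rfl
  have : IsScalarTower ℂ (CoordRing n m r) (MvPolynomial (Fin r × Fin (n + 1)) ℂ) :=
    IsScalarTower.of_algebraMap_eq fun x => ((powHom n m r).commutes x).symm
  have : FaithfulSMul (CoordRing n m r) (MvPolynomial (Fin r × Fin (n + 1)) ℂ) :=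
    (faithfulSMul_iff_algebraMap_injective _ _).2 powHom_injective
  -- Here `d = 0` enters: the transcendence degree over the coordinate ring is zero.
  have halg : Algebra.IsAlgebraic (CoordRing n m r) (MvPolynomial (Fin r × Fin (n + 1)) ℂ) := by
    rw [← trdeg_eq_zero_iff, trdeg_eq_of_isDimensionGap hd (trdeg_mvPolynomial_prod n r),
      Nat.cast_zero]
  -- Homogenizing the monomials keeps the condition polynomial in `u`. It is nonzero because it does
  -- not vanish at `u_j = (1, v_j)` for a point `v` of `D`.
  let z : MvPolynomial (Fin r × Fin (n + 1)) ℂ :=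
    (∏ j : Fin r, X (j, 0)) * (homogVand m e (genPoint n r)).det
  have hz : ∀ u : Fin r → Fin (n + 1) → ℂ, eval (fun s => u s.1 s.2) z =
      (∏ j, u j 0) * (homogVand m e u).det := by
    intro u
    rw [map_mul, map_prod, RingHom.map_det, RingHom.mapMatrix_apply, homogVand_map]
    simp [genPoint]
  have hz0 : z ≠ 0 := by
    intro h
    obtain ⟨v, hv⟩ := exists_inD (n := n) (card_B0 hrN)
    have h1 := hz fun j => (Fin.cons 1 (v j) : Fin (n + 1) → ℂ)
    have h2 : homogVand m e (fun j => (Fin.cons 1 (v j) : Fin (n + 1) → ℂ)) =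
        vand e fun j => (Fin.cons 1 (v j) : Fin (n + 1) → ℂ) := by
      ext μ β
      simp [homogVand, vand]
    rw [h, map_zero, h2] at h1
    simp only [Fin.cons_zero, Finset.prod_const_one, one_mul] at h1
    refine (inD_iff_det e fun j => (Fin.cons 1 (v j) : Fin (n + 1) → ℂ)).1 ?_ h1.symm
    simpa using hv
  obtain ⟨f, hf, hfib⟩ := exists_value_ne_zero (R := CoordRing n m r)
    (Algebra.IsAlgebraic.isAlgebraic z) hz0
  obtain ⟨p, rfl⟩ := Ideal.Quotient.mk_surjective f
  refine ⟨p, fun h => hf (Ideal.Quotient.eq_zero_iff_mem.2 h), fun u hu => ?_⟩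
  have h1 := hfib (evalCoord _ (powSum_mem_secantCone u)) (by rwa [evalCoord_mk])
    (aeval fun s => u s.1 s.2) fun x => by
      obtain ⟨q, rfl⟩ := Ideal.Quotient.mk_surjective x
      rw [evalCoord_mk, hmap, powHom_mk, aeval_eq_eval]
      exact eval_aeval_genPowSum u q
  have h2 : (aeval fun s : Fin r × Fin (n + 1) => u s.1 s.2 : _ →ₐ[ℂ] ℂ) z =
      (∏ j, u j 0) * (homogVand m e u).det := by
    rw [aeval_eq_eval]
    exact hz u
  rw [h2] at h1
  have h3 : ∀ j, u j 0 ≠ 0 := fun j =>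
    Finset.prod_ne_zero_iff.1 (left_ne_zero_of_mul h1) j (Finset.mem_univ j)
  exact ⟨h3, inD_dehomog hrN e h3 (right_ne_zero_of_mul h1)⟩

end Goodness

/-! ### General tensors -/

section Scaling

variable {n m r : ℕ}

theorem eval_aeval_C_mul_X (t : ℂ) (F : Tensor n m) (p : MvPolynomial (Fin m → Fin (n + 1)) ℂ) :
    eval F (aeval (fun i => C t * X i) p : MvPolynomial (Fin m → Fin (n + 1)) ℂ) =
      eval (t • F) p := by
  rw [← aeval_eq_eval, ← AlgHom.comp_apply, comp_aeval, ← aeval_eq_eval]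
  congr 2
  ext i
  simp

theorem smul_powSum (s : ℂ) (u : Fin r → Fin (n + 1) → ℂ) :
    powSum m (s • u) = s ^ m • powSum m u := by
  simp only [powSum, Finset.smul_sum, Pi.smul_apply, tensorPow_smul]

theorem smul_mem_secantCone (hm : 0 < m) (t : ℂ) {F : Tensor n m} (hF : F ∈ secantCone n m r) :
    t • F ∈ secantCone n m r := by
  obtain ⟨s, rfl⟩ := IsAlgClosed.exists_pow_nat_eq t hm
  intro p hp
  have hp' : ∀ u : Fin r → Fin (n + 1) → ℂ, eval (powSum m u) p = 0 := fun u => by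
    have := hp _ ⟨u, rfl⟩
    rwa [aeval_eq_eval] at this
  have h1 : (aeval (fun i => C (s ^ m) * X i) p : MvPolynomial (Fin m → Fin (n + 1)) ℂ) ∈
      vanishingIdeal ℂ (Set.range fun u : Fin r → Fin (n + 1) → ℂ => powSum m u) := by
    rintro _ ⟨u, rfl⟩
    change aeval (powSum m u) _ = (0 : ℂ)
    rw [aeval_eq_eval]
    refine (eval_aeval_C_mul_X _ _ _).trans ?_
    rw [← smul_powSum]
    exact hp' _
  have h2 := hF _ h1
  rw [aeval_eq_eval] at h2 ⊢
  exact (eval_aeval_C_mul_X _ _ _).symm.trans h2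

theorem eval_smul_of_isHomogeneous {σ : Type*} {p : MvPolynomial σ ℂ} {k : ℕ}
    (hp : p.IsHomogeneous k) (t : ℂ) (x : σ → ℂ) : eval (t • x) p = t ^ k * eval x p := by
  rw [eval_eq, eval_eq, Finset.mul_sum]
  refine Finset.sum_congr rfl fun α hα => ?_
  have h1 : α.degree = k := by
    rw [Finsupp.degree_eq_weight_one]
    exact hp (mem_support_iff.1 hα)
  have h2 : ∏ i ∈ α.support, (t • x) i ^ α i = t ^ k * ∏ i ∈ α.support, x i ^ α i := by
    simp only [Pi.smul_apply, smul_eq_mul, mul_pow, Finset.prod_mul_distrib,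
      Finset.prod_pow_eq_pow_sum]
    rw [← h1]
    rfl
  rw [h2]
  ring

/-- A property that is invariant under scaling and holds on a nonempty open subset of the cone
holds for a general tensor. -/
theorem forGeneralTensor_of_smul (hm : 0 < m) (hr : 0 < r) {P : Tensor n m → Prop}
    {p : MvPolynomial (Fin m → Fin (n + 1)) ℂ} (hp : p ∉ vanishingIdeal ℂ (secantCone n m r))
    (hP : ∀ F ∈ secantCone n m r, eval F p ≠ 0 → P F)
    (hsmul : ∀ (t : ℂ) (F : Tensor n m), t ≠ 0 → P (t • F) → P F) :
    ForGeneralTensor n m r P := by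
  -- `p` need not be homogeneous; one of its components is the required form.
  have hcomp : ∃ k, homogeneousComponent k p ∉ vanishingIdeal ℂ (secantCone n m r) := by
    by_contra! hcon
    apply hp
    rw [← sum_homogeneousComponent p]
    exact Ideal.sum_mem _ fun k _ => hcon k
  obtain ⟨k, hk⟩ := hcomp
  -- The coordinate at `(0, …, 0)` as an extra factor ensures that the witness tensor is nonzero. It
  -- takes the value `r` at the sum of powers of all-ones vectors.
  let z : Fin m → Fin (n + 1) := 0
  have hz : (X z : MvPolynomial (Fin m → Fin (n + 1)) ℂ) ∉
      vanishingIdeal ℂ (secantCone n m r) := by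
    rw [mem_vanishingIdeal_secantCone]
    intro h
    have := h fun _ => 1
    simp [powSum, tensorPow] at this
    omega
  have hprod : homogeneousComponent k p * X z ∉ vanishingIdeal ℂ (secantCone n m r) :=
    fun h => (Ideal.IsPrime.mem_or_mem inferInstance h).elim hk hz
  refine ⟨homogeneousComponent k p * X z,
    ⟨k + 1, (homogeneousComponent_isHomogeneous k p).mul (isHomogeneous_X ℂ z)⟩, ?_, ?_⟩
  · rw [mem_vanishingIdeal_secantCone] at hprod
    push Not at hprod
    obtain ⟨u, hu⟩ := hprod
    refine ⟨powSum m u, powSum_mem_secantCone u, ?_, hu⟩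
    intro h0
    rw [map_mul, eval_X, h0] at hu
    simp at hu
  · intro F hF _ hFp
    rw [map_mul] at hFp
    have hFk := left_ne_zero_of_mul hFp
    -- `q(t) = p(tF)` has a nonzero coefficient at `t^k`, so some `t ≠ 0` brings `tF` into the open
    -- set where `p` is nonzero.
    let q : Polynomial ℂ := ∑ i ∈ Finset.range (p.totalDegree + 1),
      Polynomial.monomial i (eval F (homogeneousComponent i p))
    have hq : ∀ t, q.eval t = eval (t • F) p := by
      intro t
      conv_rhs => rw [← sum_homogeneousComponent p]
      simp only [q, Polynomial.eval_finsetSum, Polynomial.eval_monomial, map_sum]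
      refine Finset.sum_congr rfl fun i _ => ?_
      rw [eval_smul_of_isHomogeneous (homogeneousComponent_isHomogeneous i p), mul_comm]
    have hkle : k ∈ Finset.range (p.totalDegree + 1) := by
      rw [Finset.mem_range]
      by_contra hcon
      rw [homogeneousComponent_eq_zero k p (by omega), map_zero] at hFk
      exact hFk rfl
    have hq0 : q ≠ 0 := by
      intro h
      have := congrArg (fun q => Polynomial.coeff q k) h
      simp only [q, Polynomial.finsetSum_coeff, Polynomial.coeff_monomial,
        Polynomial.coeff_zero, Finset.sum_ite_eq', if_pos hkle] at this
      exact hFk this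
    obtain ⟨t, ht⟩ : ∃ t, (q * Polynomial.X).eval t ≠ 0 := by
      by_contra! hcon
      exact mul_ne_zero hq0 Polynomial.X_ne_zero (Polynomial.funext fun t => by simp [hcon t])
    rw [Polynomial.eval_mul, Polynomial.eval_X] at ht
    refine hsmul t F (right_ne_zero_of_mul ht) (hP _ (smul_mem_secantCone hm t hF) ?_)
    rw [← hq]
    exact left_ne_zero_of_mul ht

/-- Multiplication of the coefficients `λ_j` by `t`. -/
def scaleCoef (t : ℂ) (x : Fin r → Fin (n + 1) → ℂ) : Fin r → Fin (n + 1) → ℂ :=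
  fun j => Fin.cons (t * x j 0) (Fin.tail (x j))

theorem scaleCoef_mem_sliceSet {d : ℕ} {F : Tensor n m} {a : Fin d × (B0 n r × B1 n r) → ℂ}
    {b : Fin d → ℂ} {x : Fin r → Fin (n + 1) → ℂ} (hx : x ∈ sliceSet F a b) (t : ℂ) :
    scaleCoef t x ∈ sliceSet (t • F) a b := by
  obtain ⟨rfl, hD, G, hG, hGab⟩ := hx
  refine ⟨?_, by simpa [scaleCoef] using hD, G, by simpa [scaleCoef] using hG, hGab⟩
  ext i
  simp [wsum, scaleCoef, Finset.mul_sum, mul_assoc]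

theorem scaleCoef_scaleCoef {t : ℂ} (ht : t ≠ 0) (x : Fin r → Fin (n + 1) → ℂ) :
    scaleCoef t⁻¹ (scaleCoef t x) = x := by
  ext j c
  refine Fin.cases ?_ (fun i => ?_) c
  · simp [scaleCoef, ht]
  · simp [scaleCoef, Fin.tail]

theorem HasGeneralSlices.of_smul {d : ℕ} {F : Tensor n m} {t : ℂ} (ht : t ≠ 0)
    (h : HasGeneralSlices r d (t • F)) : HasGeneralSlices r d F := by
  obtain ⟨Q, hQ, hslice⟩ := h
  refine ⟨Q, hQ, fun a b hab => ?_⟩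
  obtain ⟨⟨x, hx⟩, hfin, hnz⟩ := hslice a b hab
  refine ⟨⟨scaleCoef t⁻¹ x, ?_⟩, (hfin.image (scaleCoef t⁻¹)).subset fun y hy => ?_, ?_⟩
  · have := scaleCoef_mem_sliceSet hx t⁻¹
    rwa [smul_smul, inv_mul_cancel₀ ht, one_smul] at this
  · exact ⟨scaleCoef t y, scaleCoef_mem_sliceSet hy t, scaleCoef_scaleCoef ht y⟩
  · intro y hy j h0
    refine hnz _ (scaleCoef_mem_sliceSet hy t) j ?_
    simp [scaleCoef, h0]

/-- The two open conditions are intersected by multiplying their polynomials, using that the ideal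
of the cone is prime. Both properties survive rescaling `F`, with `t = s^m` acting on tuples as
multiplication by `s`. -/
theorem exists_forGeneralTensor {d : ℕ} (hm : 0 < m) (hr : 0 < r) (hrN : r ≤ (n + m).choose m)
    (hd : IsDimensionGap n m r d) :
    ForGeneralTensor n m r fun F => HasGeneralSlices r d F ∧
      (d = 0 → ∀ u : Fin r → Fin (n + 1) → ℂ, F = powSum m u →
        (∀ j, u j 0 ≠ 0) ∧ InD fun j => dehomog (u j)) := by
  obtain ⟨p, hp, hslice⟩ := exists_hasGeneralSlices hm hr hrN hd
  have h2 : ∃ q : MvPolynomial (Fin m → Fin (n + 1)) ℂ, q ∉ vanishingIdeal ℂ (secantCone n m r) ∧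
      (d = 0 → ∀ u : Fin r → Fin (n + 1) → ℂ, eval (powSum m u) q ≠ 0 →
        (∀ j, u j 0 ≠ 0) ∧ InD fun j => dehomog (u j)) := by
    by_cases h0 : d = 0
    · subst h0
      obtain ⟨q, hq, h⟩ := exists_general_inD hrN hd
      exact ⟨q, hq, fun _ => h⟩
    · refine ⟨1, ?_, fun h => absurd h h0⟩
      rw [← Ideal.eq_top_iff_one]
      exact Ideal.IsPrime.ne_top'
  obtain ⟨q, hq, hinD⟩ := h2
  refine forGeneralTensor_of_smul hm hr (p := p * q)
    (fun h => (Ideal.IsPrime.mem_or_mem inferInstance h).elim hp hq) ?_ ?_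
  · intro F hF hFpq
    rw [map_mul] at hFpq
    refine ⟨hslice F hF (left_ne_zero_of_mul hFpq), fun h0 u hu => ?_⟩
    subst hu
    exact hinD h0 u (right_ne_zero_of_mul hFpq)
  · rintro t F ht ⟨h1, h2⟩
    refine ⟨h1.of_smul ht, fun h0 u hu => ?_⟩
    obtain ⟨s, rfl⟩ := IsAlgClosed.exists_pow_nat_eq t hm
    have hs : s ≠ 0 := by
      rintro rfl
      exact ht (zero_pow hm.ne')
    obtain ⟨h3, h4⟩ := h2 h0 (s • u) (by rw [hu, smul_powSum])
    refine ⟨fun j => right_ne_zero_of_mul (a := s) (h3 j), ?_⟩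
    have h5 : (fun j => dehomog ((s • u) j)) = fun j => dehomog (u j) := by
      ext j i
      simp only [dehomog, Pi.smul_apply, smul_eq_mul]
      rw [mul_div_mul_left _ _ hs]
    rwa [h5] at h4

end Scaling

/-! ### Parametrizations of the space of generating matrices -/

section Parametrizations

variable {n m r : ℕ}

theorem pairing_phi_mul (F : Tensor n m) (G : GMatrix n r) (α : B1 n r) (γ : Fin n →₀ ℕ) :
    pairing (phi G α * monomial γ 1) F =
      ∑ β : B0 n r, G β α * entry F (β.1 + γ) - entry F (α.1 + γ) := by
  have h1 : phi G α * monomial γ 1 =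
      ∑ β : B0 n r, G β α • basisMonomials (Fin n) ℂ (β.1 + γ) -
        basisMonomials (Fin n) ℂ (α.1 + γ) := by
    simp [phi, sub_mul, Finset.sum_mul, monomial_mul, smul_monomial]
  rw [pairing_eq_constr, h1, map_sub, map_sum]
  simp only [map_smul, Module.Basis.constr_basis, smul_eq_mul]

/-- The direction of the affine space of generating matrices. -/
noncomputable def generatingDirection (r : ℕ) (F : Tensor n m) : Submodule ℂ (GMatrix n r) where
  carrier := {H | ∀ (α : B1 n r) (γ : Fin n →₀ ℕ), α.1.degree + γ.degree ≤ m →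
    ∑ β : B0 n r, H β α * entry F (β.1 + γ) = 0}
  zero_mem' := by
    intro α γ _
    simp
  add_mem' := by
    intro H H' h h' α γ hd
    simp only [Matrix.add_apply, add_mul, Finset.sum_add_distrib, h α γ hd, h' α γ hd, add_zero]
  smul_mem' := by
    intro c H h α γ hd
    simp only [Matrix.smul_apply, smul_eq_mul, mul_assoc, ← Finset.mul_sum, h α γ hd, mul_zero]

/-- The conditions are affine-linear in `G`, so a solution and a basis of the homogeneous solutions
provide `C` and `N`. -/
theorem exists_parametrization {F : Tensor n m} (h : (generatingMatrices r F).Nonempty) :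
    ∃ ℓ, Nonempty (Parametrization r F ℓ) := by
  obtain ⟨C, hC⟩ := h
  let b := Module.finBasis ℂ (generatingDirection r F)
  refine ⟨Module.finrank ℂ (generatingDirection r F), ⟨⟨C,
    (generatingDirection r F).subtype ∘ₗ b.equivFun.symm.toLinearMap, ?_, ?_⟩⟩⟩
  · exact (Subtype.val_injective).comp b.equivFun.symm.injective
  · ext G
    constructor
    · rintro ⟨ω, rfl⟩ α γ hd
      have h1 := hC α γ hd
      have h2 := (b.equivFun.symm ω).2 α γ hd
      rw [pairing_phi_mul] at h1 ⊢
      have h3 : ∀ β, (C + (b.equivFun.symm ω : GMatrix n r)) β α * entry F (β.1 + γ) =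
          C β α * entry F (β.1 + γ) +
            (b.equivFun.symm ω : GMatrix n r) β α * entry F (β.1 + γ) := fun β => by
        rw [Matrix.add_apply, add_mul]
      refine Eq.trans (congrArg (· - _) (Finset.sum_congr rfl fun β _ => h3 β)) ?_
      rw [Finset.sum_add_distrib, h2, add_zero, h1]
    · intro hG
      have hmem : G - C ∈ generatingDirection r F := by
        intro α γ hd
        have h1 := hG α γ hd
        have h2 := hC α γ hd
        rw [pairing_phi_mul] at h1 h2
        simp only [Matrix.sub_apply, sub_mul, Finset.sum_sub_distrib]
        rw [sub_eq_zero.1 h1, sub_eq_zero.1 h2, sub_self]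
      refine ⟨b.equivFun ⟨G - C, hmem⟩, ?_⟩
      simp

theorem Parametrization.G_mem {ℓ : ℕ} {F : Tensor n m} (P : Parametrization r F ℓ)
    (ω : Fin ℓ → ℂ) : P.G ω ∈ generatingMatrices r F := by
  rw [← P.range_eq]
  exact ⟨ω, rfl⟩

theorem Parametrization.exists_G_eq {ℓ : ℕ} {F : Tensor n m} (P : Parametrization r F ℓ)
    {G : GMatrix n r} (hG : G ∈ generatingMatrices r F) : ∃ ω, P.G ω = G := by
  rw [← P.range_eq] at hG
  exact hG

theorem Parametrization.G_injective {ℓ : ℕ} {F : Tensor n m} (P : Parametrization r F ℓ) :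
    Function.Injective P.G := fun _ _ h => P.injective (add_left_cancel h)

/-- General equations for the generating matrix restrict to general equations for the parameter. -/
theorem Parametrization.forGeneralEquations {ℓ d : ℕ} {F : Tensor n m}
    (P : Parametrization r F ℓ) {Q : MvPolynomial ((Fin d × (B0 n r × B1 n r)) ⊕ Fin d) ℂ}
    (hQ : Q ≠ 0) :
    ForGeneralEquations d ℓ fun a b => ∃ (A : Fin d × (B0 n r × B1 n r) → ℂ) (B : Fin d → ℂ),
      eval (Sum.elim A B) Q ≠ 0 ∧
      ∀ ω k, ∑ p, A (k, p) * P.G ω p.1 p.2 = B k ↔ a k ⬝ᵥ ω = b k := by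
  classical
  obtain ⟨y, hy⟩ : ∃ y, eval y Q ≠ 0 := by
    by_contra! hcon
    exact hQ (MvPolynomial.funext fun y => by rw [hcon y, map_zero])
  let A₀ : Fin d × (B0 n r × B1 n r) → ℂ := fun s => y (Sum.inl s)
  -- The left inverse lifts an equation `a` in `ω` to an equation `A` in `G` which restricts to `a`
  -- along `N`; `B` absorbs the constant from `C`. Normalizing the lift by `A₀` makes it hit `y` at
  -- `a = a₀` for a suitable `b`, so the pullback of `Q` is not zero.
  obtain ⟨L, hL⟩ := P.N.exists_leftInverse_of_injective (LinearMap.ker_eq_bot.2 P.injective)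
  let a₀ : Fin d → Fin ℓ → ℂ := fun k i => ∑ p, A₀ (k, p) * P.N (Pi.single i 1) p.1 p.2
  let ε : B0 n r × B1 n r → GMatrix n r := fun p => Matrix.single p.1 p.2 1
  have hsum : ∀ G : GMatrix n r, G = ∑ p, G p.1 p.2 • ε p := by
    intro G
    conv_lhs => rw [Matrix.matrix_eq_sum_single G]
    rw [Fintype.sum_prod_type]
    simp [ε, Matrix.smul_single]
  have hN : ∀ (ω : Fin ℓ → ℂ) (p : B0 n r × B1 n r), P.N ω p.1 p.2 = ∑ i, ω i * P.N (Pi.single i 1) p.1 p.2 := by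
    intro ω p
    conv_lhs => rw [pi_eq_sum_univ' ω]
    rw [map_sum, Matrix.sum_apply]
    simp only [map_smul, Matrix.smul_apply, smul_eq_mul]
  have hLN : ∀ ω i, ∑ p, L (ε p) i * P.N ω p.1 p.2 = ω i := by
    intro ω i
    have h1 : L (P.N ω) = ω := LinearMap.congr_fun hL ω
    conv_rhs => rw [← h1, hsum (P.N ω), map_sum, Finset.sum_apply]
    refine Finset.sum_congr rfl fun p _ => ?_
    rw [map_smul, Pi.smul_apply, smul_eq_mul, mul_comm]
  -- the equations for the matrix, as polynomials in the equations for the parameter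
  let Apol : Fin d × (B0 n r × B1 n r) → MvPolynomial ((Fin d × Fin ℓ) ⊕ Fin d) ℂ := fun s =>
    MvPolynomial.C (A₀ s) + ∑ i, (X (Sum.inl (s.1, i)) - MvPolynomial.C (a₀ s.1 i)) *
      MvPolynomial.C (L (ε s.2) i)
  let Bpol : Fin d → MvPolynomial ((Fin d × Fin ℓ) ⊕ Fin d) ℂ := fun k =>
    X (Sum.inr k) + ∑ p : B0 n r × B1 n r, Apol (k, p) * MvPolynomial.C (P.C p.1 p.2)
  let Aval : (Fin d → Fin ℓ → ℂ) → Fin d × (B0 n r × B1 n r) → ℂ := fun a s =>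
    A₀ s + ∑ i, (a s.1 i - a₀ s.1 i) * L (ε s.2) i
  let Bval : (Fin d → Fin ℓ → ℂ) → (Fin d → ℂ) → Fin d → ℂ := fun a b k =>
    b k + ∑ p : B0 n r × B1 n r, Aval a (k, p) * P.C p.1 p.2
  have heval : ∀ a b, eval (Sum.elim (fun s => a s.1 s.2) b) (aeval (Sum.elim Apol Bpol) Q) =
      eval (Sum.elim (Aval a) (Bval a b)) Q := by
    intro a b
    rw [← aeval_eq_eval, ← AlgHom.comp_apply, comp_aeval, ← aeval_eq_eval]
    congr 2
    ext s
    rcases s with s | k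
    · simp [Apol, Aval]
    · simp [Apol, Aval, Bpol, Bval]
  refine ⟨aeval (Sum.elim Apol Bpol) Q, fun h0 => hy ?_, fun a b hab => ?_⟩
  · have h1 := heval a₀ fun k => y (Sum.inr k) - ∑ p : B0 n r × B1 n r, A₀ (k, p) * P.C p.1 p.2
    rw [h0, map_zero] at h1
    rw [h1]
    congr 2
    ext s
    rcases s with s | k
    · simp [Aval, A₀]
    · simp [Aval, Bval]
  · refine ⟨Aval a, Bval a b, by rwa [← heval], fun ω k => ?_⟩
    have h1 : ∑ p, Aval a (k, p) * P.N ω p.1 p.2 = a k ⬝ᵥ ω := by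
      have h2 : ∑ p, A₀ (k, p) * P.N ω p.1 p.2 = ∑ i, a₀ k i * ω i := by
        simp only [hN ω, a₀, Finset.mul_sum, Finset.sum_mul]
        rw [Finset.sum_comm]
        refine Finset.sum_congr rfl fun i _ => Finset.sum_congr rfl fun p _ => by ring
      have h3 : ∑ p, (∑ i, (a k i - a₀ k i) * L (ε p) i) * P.N ω p.1 p.2 =
          ∑ i, (a k i - a₀ k i) * ω i := by
        simp only [Finset.sum_mul]
        rw [Finset.sum_comm]
        refine Finset.sum_congr rfl fun i _ => ?_
        rw [← hLN ω i, Finset.mul_sum]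
        exact Finset.sum_congr rfl fun p _ => by ring
      simp only [Aval, add_mul, Finset.sum_add_distrib]
      rw [h2, h3, ← Finset.sum_add_distrib, dotProduct]
      exact Finset.sum_congr rfl fun i _ => by ring
    have h4 : ∑ p, Aval a (k, p) * P.G ω p.1 p.2 =
        ∑ p : B0 n r × B1 n r, Aval a (k, p) * P.C p.1 p.2 + a k ⬝ᵥ ω := by
      rw [← h1, ← Finset.sum_add_distrib]
      refine Finset.sum_congr rfl fun p _ => ?_
      rw [Parametrization.G, Matrix.add_apply, mul_add]
    rw [h4]
    simp only [Bval]
    rw [add_comm]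
    exact add_left_inj _

end Parametrizations

/-! ### Outputs of the algorithm -/

section Outputs

variable {n m r : ℕ}

theorem IsOutput.eq_powSum {F : Tensor n m} {G : GMatrix n r} {u : Fin r → Fin (n + 1) → ℂ}
    (h : IsOutput F G u) : F = powSum m u := by
  obtain ⟨v, lam, ρ, -, -, rfl, hρ, hu⟩ := h
  refine Finset.sum_congr rfl fun j _ => ?_
  rw [hu, tensorPow_smul, hρ]

theorem powSum_zero (hm : 0 < m) : powSum m (0 : Fin r → Fin (n + 1) → ℂ) = 0 := by
  ext i
  simp [powSum, tensorPow, hm.ne']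

theorem ne_zero_of_powSum (hm : 0 < m) {F : Tensor n m} (hF : F ≠ 0)
    {u : Fin r → Fin (n + 1) → ℂ} (h : F = powSum m u) : u ≠ 0 := by
  rintro rfl
  exact hF (h.trans (powSum_zero hm))

theorem exists_represents (hm : 0 < m) {F : Tensor n m} (hF : F ≠ 0)
    {u : Fin r → Fin (n + 1) → ℂ} (h : F = powSum m u) :
    ∃ c : DecomposingClass r F, Represents u c :=
  ⟨Quotient.mk _ ⟨_, u, ne_zero_of_powSum hm hF h, rfl, h⟩, h, _, ne_zero_of_powSum hm hF h,
    rfl, rfl⟩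

theorem Represents.unique {F : Tensor n m} {u : Fin r → Fin (n + 1) → ℂ}
    {c c' : DecomposingClass r F} (h : Represents u c) (h' : Represents u c') : c = c' := by
  obtain ⟨-, U, hu, e, rfl⟩ := h
  obtain ⟨-, U', hu', e', rfl⟩ := h'
  rw [Subtype.ext (e.symm.trans e')]

theorem Represents.of_equiv (hm : 0 < m) {F : Tensor n m} (hF : F ≠ 0)
    {u u' : Fin r → Fin (n + 1) → ℂ} {c : DecomposingClass r F} (h : Represents u c)
    (h' : F = powSum m u') (ν : Equiv.Perm (Fin r)) (τ : Fin r → ℂˣ) (hτ : ∀ j, τ j ^ m = 1)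
    (hu : ∀ j, u' j = (τ j : ℂ) • u (ν j)) : Represents u' c := by
  obtain ⟨-, U, hu0, e, rfl⟩ := h
  have hu0' := ne_zero_of_powSum hm hF h'
  refine ⟨h', ⟨Projectivization.mk ℂ u' hu0', u', hu0', rfl, h'⟩, hu0', rfl, ?_⟩
  refine Quotient.sound ?_
  exact (fiberSetoid r F).symm ⟨u, u', hu0, hu0', e, rfl, ν, τ, hτ, hu⟩

theorem exists_enumeration {G : GMatrix n r} (h : Nondefective G) :
    ∃ v : Fin r → Fin n → ℂ, Function.Injective v ∧ Set.range v = zeros G := by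
  have hfin : (zeros G).Finite := Set.finite_of_encard_eq_coe h
  have : Finite (zeros G) := hfin
  have hcard : Nat.card (zeros G) = r := by
    rw [Nat.card_coe_set_eq, Set.ncard, show (zeros G).encard = r from h]
    rfl
  let e : Fin r ≃ zeros G := (Finite.equivFinOfCardEq hcard).symm
  refine ⟨fun j => (e j).1, Subtype.val_injective.comp e.injective, ?_⟩
  rw [show (fun j => (e j).1) = Subtype.val ∘ e from rfl, e.surjective.range_comp,
    Subtype.range_coe]

/-- Two outputs computed from the same generating matrix are equivalent. -/
theorem IsOutput.equiv (hm : 0 < m) (hr : 0 < r) (hrN : r ≤ (n + m).choose m) {F : Tensor n m}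
    {G : GMatrix n r} {u u' : Fin r → Fin (n + 1) → ℂ} (h : IsOutput F G u)
    (h' : IsOutput F G u') :
    ∃ (ν : Equiv.Perm (Fin r)) (τ : Fin r → ℂˣ),
      (∀ j, τ j ^ m = 1) ∧ ∀ j, u' j = (τ j : ℂ) • u (ν j) := by
  obtain ⟨v, lam, ρ, hv, hvG, hF, hρ, hu⟩ := h
  obtain ⟨v', lam', ρ', hv', hvG', hF', hρ', hu'⟩ := h'
  have hex : ∀ j, ∃ k, v k = v' j := by
    intro j
    have : v' j ∈ Set.range v := by
      rw [hvG, ← hvG']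
      exact ⟨j, rfl⟩
    exact this
  choose f hf using hex
  have hfinj : Function.Injective f := by
    intro j k hjk
    apply hv'
    rw [← hf, ← hf, hjk]
  let ν : Equiv.Perm (Fin r) := Equiv.ofBijective f (Finite.injective_iff_bijective.1 hfinj)
  have hν : ∀ j, v (ν j) = v' j := hf
  have hlam : ∀ j, lam (ν j) = lam' j := by
    have hD : InD v := inD_of_injective (G := G) hr hv fun j => by
      rw [← hvG]
      exact ⟨j, rfl⟩
    have h1 : ∑ j, lam' j • tensorPow m (homog (v' j)) =
        ∑ j, lam' (ν.symm j) • tensorPow m (homog (v j)) := by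
      rw [← Equiv.sum_comp ν fun j => lam' (ν.symm j) • tensorPow m (homog (v j))]
      simp only [hν, Equiv.symm_apply_apply]
    intro j
    have h2 := congrFun (coefficients_unique hrN hD (hF.symm.trans (hF'.trans h1))) (ν j)
    simpa using h2
  have hex' : ∀ j, ∃ τ : ℂˣ, τ ^ m = 1 ∧ ρ' j = τ * ρ (ν j) := by
    intro j
    have hpow : ρ (ν j) ^ m = ρ' j ^ m := by rw [hρ, hρ', hlam]
    by_cases h0 : ρ (ν j) = 0
    -- If the coefficient is zero, both roots vanish and any root of unity will do.
    · refine ⟨1, one_pow m, ?_⟩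
      rw [h0, zero_pow hm.ne'] at hpow
      rw [h0, mul_zero]
      exact eq_zero_of_pow_eq_zero hpow.symm
    · have h0' : ρ' j ≠ 0 := by
        intro h1
        rw [h1, zero_pow hm.ne'] at hpow
        exact h0 (eq_zero_of_pow_eq_zero hpow)
      refine ⟨Units.mk0 _ (div_ne_zero h0' h0), ?_, (div_mul_cancel₀ _ h0).symm⟩
      apply Units.ext
      rw [Units.val_pow_eq_pow_val, Units.val_mk0, div_pow, hpow, Units.val_one,
        div_self (pow_ne_zero _ h0')]
  choose τ hτ hτρ using hex'
  refine ⟨ν, τ, hτ, fun j => ?_⟩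
  rw [hu, hu', hν, smul_smul, hτρ]

/-- The dehomogenized points exhaust the zeros of `φ[G]`, and `(u_j)_0` is an admissible root of
`λ_j = (u_j)_0 ^ m`. -/
theorem isOutput_of_inD (hr : 0 < r) (hrN : r ≤ (n + m).choose m) {F : Tensor n m}
    {G : GMatrix n r} {u : Fin r → Fin (n + 1) → ℂ} (hF : F = powSum m u) (hu : ∀ j, u j 0 ≠ 0)
    (hD : InD fun j => dehomog (u j)) (hG : ∀ j, dehomog (u j) ∈ zeros G) : IsOutput F G u := by
  refine ⟨fun j => dehomog (u j), fun j => u j 0 ^ m, fun j => u j 0, hD.injective,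
    (zeros_eq_range hr (card_B0 hrN) hD hG).symm, ?_, fun _ => rfl,
    fun j => (smul_homog_dehomog (hu j)).symm⟩
  rw [hF, sum_smul_tensorPow, powSum_eq_wsum hu]

theorem dehomog_smul_homog {ρ : ℂ} (hρ : ρ ≠ 0) (v : Fin n → ℂ) : dehomog (ρ • homog v) = v := by
  ext i
  simp [dehomog, homog, hρ]

/-- The algorithm is successful for linear equations that cut out a finite nonempty set of
decompositions with nonzero coefficients. -/
theorem run_of_sliceSet (hm : 0 < m) (hr : 0 < r) (hrN : r ≤ (n + m).choose m) {ℓ d : ℕ}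
    {F : Tensor n m} (hF : F ≠ 0) (P : Parametrization r F ℓ) {a : Fin d → Fin ℓ → ℂ}
    {b : Fin d → ℂ} {A : Fin d × (B0 n r × B1 n r) → ℂ} {B : Fin d → ℂ}
    (hcompat : ∀ ω k, ∑ p, A (k, p) * P.G ω p.1 p.2 = B k ↔ a k ⬝ᵥ ω = b k)
    (hne : (sliceSet F A B).Nonempty) (hfin : (sliceSet F A B).Finite)
    (hnz : ∀ x ∈ sliceSet F A B, ∀ j, x j 0 ≠ 0) :
    RunSucceeds P a b ∧ classesFound P a b = slice P a b ∧
      (slice P a b).Finite ∧ (slice P a b).Nonempty := by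
  obtain ⟨x₀, hx₀⟩ := hne
  have hcard := card_B0 hrN
  -- each solution comes from a decomposition
  have hsol : ∀ ω ∈ nondefectiveSolutions P a b, ∃ x ∈ sliceSet F A B,
      (∀ j, Fin.tail (x j) ∈ zeros (P.G ω)) ∧ ∃ u, IsOutput F (P.G ω) u := by
    rintro ω ⟨⟨-, hω⟩, hnd⟩
    obtain ⟨v, hv, hvG⟩ := exists_enumeration hnd
    have hvz : ∀ j, v j ∈ zeros (P.G ω) := fun j => hvG ▸ ⟨j, rfl⟩
    have hD := inD_of_injective hr hv hvz
    have hGF := P.G_mem ω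
    have hdec : ∃ lam : Fin r → ℂ, F = ∑ j, lam j • tensorPow m (homog (v j)) := by
      -- `x₀` only certifies that `F` is some weighted sum of powers; the decomposition obtained
      -- uses the zeros of `φ[G(ω)]`.
      have h1 := exists_decomposition hr hrN x₀ (G := P.G ω) (by rwa [hx₀.1]) hD hvz
      rwa [hx₀.1] at h1
    obtain ⟨lam, hlam⟩ := hdec
    choose ρ hρ using fun j => IsAlgClosed.exists_pow_nat_eq (lam j) hm
    refine ⟨fun j => Fin.cons (lam j) (v j), ⟨?_, by simpa using hD, P.G ω, by simpa using hvz,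
      fun k => (hcompat ω k).2 (hω k)⟩, by simpa using hvz, fun j => ρ j • homog (v j),
      v, lam, ρ, hv, hvG, hlam, hρ, fun _ => rfl⟩
    rw [← sum_smul_tensorPow, ← hlam]
  have hrun : RunSucceeds P a b := by
    refine ⟨?_, fun ω hω => ?_⟩
    · refine (hfin.biUnion (t := fun x => {ω | x ∈ sliceSet F A B ∧
        ∀ j, Fin.tail (x j) ∈ zeros (P.G ω)}) fun x _ => ?_).subset fun ω hω => ?_
      -- A decomposition in `D` determines its generating matrix, hence `ω`, so the finitely many
      -- decompositions account for finitely many solutions.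
      · refine Set.Subsingleton.finite ?_
        rintro ω ⟨⟨-, hD, -⟩, h⟩ ω' ⟨-, h'⟩
        exact P.G_injective (generatingMatrix_unique hcard hD h h')
      · obtain ⟨x, hx, hz, -⟩ := hsol ω hω
        exact Set.mem_biUnion hx ⟨hx, hz⟩
    · obtain ⟨-, -, -, u, hu⟩ := hsol ω hω
      obtain ⟨c, hc⟩ := exists_represents hm hF hu.eq_powSum
      refine ⟨⟨u, hu⟩, c, fun u' hu' => ?_⟩
      obtain ⟨ν, τ, hτ, e⟩ := hu.equiv hm hr hrN hu'
      exact hc.of_equiv hm hF hu'.eq_powSum ν τ hτ e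
  have heq : classesFound P a b = slice P a b := by
    ext c
    constructor
    · rintro ⟨ω, ⟨⟨-, hω⟩, -⟩, u, ⟨v, lam, ρ, hv, hvG, hlam, hρ, hu⟩, hc⟩
      have hvz : ∀ j, v j ∈ zeros (P.G ω) := fun j => hvG ▸ ⟨j, rfl⟩
      have hD := inD_of_injective hr hv hvz
      have hx : (fun j => (Fin.cons (lam j) (v j) : Fin (n + 1) → ℂ)) ∈ sliceSet F A B :=
        ⟨by rw [← sum_smul_tensorPow, ← hlam], by simpa using hD, P.G ω, by simpa using hvz,
          fun k => (hcompat ω k).2 (hω k)⟩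
      -- Nonzero coefficients are needed to recover the zero `v_j` by dehomogenizing the output
      -- `u_j`.
      have hρ0 : ∀ j, ρ j ≠ 0 := by
        intro j h0
        have h1 := hnz _ hx j
        rw [Fin.cons_zero, ← hρ, h0, zero_pow hm.ne'] at h1
        exact h1 rfl
      have hdh : ∀ j, dehomog (u j) = v j := fun j => by
        rw [hu, dehomog_smul_homog (hρ0 j)]
      refine ⟨u, hc, fun j => ?_, by simpa only [hdh] using hD, ω, by simpa only [hdh] using hvz,
        hω⟩
      rw [hu]
      simpa [homog] using hρ0 j
    · rintro ⟨u, hc, hu, hD, ω, hz, hω⟩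
      exact ⟨ω, ⟨⟨companion_commute hcard hD hz, hω⟩, nondefective_of_inD hr hcard hD hz⟩, u,
        isOutput_of_inD hr hrN hc.1 hu hD hz, hc⟩
  refine ⟨hrun, heq, ?_, ?_⟩
  · rw [← heq]
    refine (hrun.1.biUnion (t := fun ω => {c | ω ∈ nondefectiveSolutions P a b ∧
      ∃ u, IsOutput F (P.G ω) u ∧ Represents u c}) fun ω _ => ?_).subset ?_
    · refine Set.Subsingleton.finite ?_
      rintro c ⟨hω, u, hu, hc⟩ c' ⟨-, u', hu', hc'⟩
      obtain ⟨-, c₀, h₀⟩ := hrun.2 ω hω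
      rw [hc.unique (h₀ u hu), hc'.unique (h₀ u' hu')]
    · rintro c ⟨ω, hω, u, hu, hc⟩
      exact Set.mem_biUnion hω ⟨hω, u, hu, hc⟩
  · have hnz₀ := hnz x₀ hx₀
    obtain ⟨hF₀, hD, G, hG, hGAB⟩ := hx₀
    -- For nonemptiness: the matrix belonging to the decomposition `x₀` is a generating matrix of
    -- `F`, so it has a parameter, and `m`-th roots of the coefficients give a tuple in the slice.
    obtain ⟨ω, rfl⟩ := P.exists_G_eq (G := G) (by
      rw [← hF₀]
      exact mem_generatingMatrices x₀ hG)
    choose ρ hρ using fun j => IsAlgClosed.exists_pow_nat_eq (x₀ j 0) hm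
    have hρ0 : ∀ j, ρ j ≠ 0 := by
      intro j h0
      have h1 := hnz₀ j
      rw [← hρ, h0, zero_pow hm.ne'] at h1
      exact h1 rfl
    have hdh : ∀ j, dehomog (ρ j • homog (Fin.tail (x₀ j))) = Fin.tail (x₀ j) := fun j =>
      dehomog_smul_homog (hρ0 j) _
    have hpow : F = powSum m fun j => ρ j • homog (Fin.tail (x₀ j)) := by
      rw [← hF₀, wsum_eq, powSum]
      simp only [tensorPow_smul, hρ]
    obtain ⟨c, hc⟩ := exists_represents hm hF hpow
    refine ⟨c, _, hc, fun j => ?_, by simpa only [hdh] using hD, ω,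
      by simpa only [hdh] using hG, fun k => (hcompat ω k).1 (hGAB k)⟩
    simpa [homog] using hρ0 j

end Outputs

end STD

open STD
theorem mainTheorem6 (n m r d : ℕ) (hm : 0 < m) (hr : 0 < r) (hrN : r ≤ (n + m).choose m)
    (hd : IsDimensionGap n m r d) :
    ForGeneralTensor n m r fun F =>
      (∃ ℓ, Nonempty (Parametrization r F ℓ)) ∧
      ∀ (ℓ : ℕ) (P : Parametrization r F ℓ),
        (d = 0 → ∀ (a : Fin d → Fin ℓ → ℂ) (b : Fin d → ℂ),
          RunSucceeds P a b ∧ classesFound P a b = Set.univ) ∧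
        (0 < d → ForGeneralEquations d ℓ fun a b =>
          RunSucceeds P a b ∧ classesFound P a b = slice P a b ∧
            (slice P a b).Finite ∧ (slice P a b).Nonempty) := by
  obtain ⟨p, hp, hne, hgen⟩ := exists_forGeneralTensor hm hr hrN hd
  refine ⟨p, hp, hne, fun F hF hF0 hFp => ?_⟩
  obtain ⟨⟨Q, hQ, hslice⟩, hgood⟩ := hgen F hF hF0 hFp
  -- One admissible choice of equations already yields a decomposition in `D`, hence a generating
  -- matrix, as Step 0 requires. For `d = 0` there are no equations, so this choice also serves the
  -- run itself.
  obtain ⟨y, hy⟩ : ∃ y, MvPolynomial.eval y Q ≠ 0 := by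
    by_contra! hcon
    exact hQ (MvPolynomial.funext fun y => by rw [hcon y, map_zero])
  rw [← Sum.elim_comp_inl_inr y] at hy
  obtain ⟨⟨x₀, hx₀⟩, hfin, hnz⟩ := hslice _ _ hy
  refine ⟨exists_parametrization ?_, fun ℓ P => ⟨fun h0 a b => ?_, fun _ => ?_⟩⟩
  · obtain ⟨rfl, -, G, hG, -⟩ := hx₀
    exact ⟨G, mem_generatingMatrices x₀ hG⟩
  · subst h0
    obtain ⟨hrun, heq, -, -⟩ := run_of_sliceSet hm hr hrN hF0 P (a := a) (b := b)
      (fun _ k => k.elim0) ⟨x₀, hx₀⟩ hfin hnz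
    refine ⟨hrun, ?_⟩
    rw [heq, Set.eq_univ_iff_forall]
    intro c
    -- Without equations the slice consists of all classes of decompositions in `D`. Every `u` in
    -- the fiber is of this kind, with generating matrix `V⁻¹ W`.
    obtain ⟨⟨U, u, hu, rfl, hFu⟩, rfl⟩ := Quotient.exists_rep c
    obtain ⟨hu0, hD⟩ := hgood rfl u hFu
    let x : Fin r → Fin (n + 1) → ℂ := fun j => Fin.cons (u j 0 ^ m) (dehomog (u j))
    let e : B0 n r ≃ Fin r := Fintype.equivFinOfCardEq (card_B0 hrN)
    classical
    have hdet := (inD_iff_det e x).1 (by simpa [x] using hD)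
    have hG := (zeros_iff_vand_mul e x ((vand e x)⁻¹ * wand e x)).2 (by
      rw [← Matrix.mul_assoc, Matrix.mul_nonsing_inv _ (isUnit_iff_ne_zero.2 hdet), Matrix.one_mul])
    have hmem := mem_generatingMatrices (m := m) x hG
    rw [← powSum_eq_wsum hu0, ← hFu] at hmem
    obtain ⟨ω, hω⟩ := P.exists_G_eq hmem
    refine ⟨u, ⟨hFu, _, hu, rfl, rfl⟩, hu0, hD, ω, ?_, fun k => k.elim0⟩
    rw [hω]
    simpa [x] using hG
  · obtain ⟨q, hq, hqP⟩ := P.forGeneralEquations hQ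
    refine ⟨q, hq, fun a b hab => ?_⟩
    obtain ⟨A, B, hAB, hcompat⟩ := hqP a b hab
    obtain ⟨hne, hfin, hnz⟩ := hslice A B hAB
    exact run_of_sliceSet hm hr hrN hF0 P hcompat hne hfin hnz
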